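/- Set $c_0:=0.001$. For $x\in\mathbb{R}^n$ let $$\|x\|_{\psi,n}:=\inf\Big\{\lambda>0:\ \frac{1}{en}\sum_{i=1}^n e^{|x_i|/\lambda}\le 1\Big\}.$$ For sequences ${\bf d}^{in}=({\bf d}^{in}_i)_{i\le n}$, ${\bf d}^{out}=({\bf d}^{out}_i)_{i\le n}$ of non-negative integers let $\mathcal{M}_n({\bf d}^{in},{\bf d}^{out})$ be the set of all $n\times n$ matrices $M$ with entries in $\{0,1\}$ whose $i$-th column contains exactly ${\bf d}^{in}_i$ ones and whose $i$-th row contains exactly ${\bf d}^{out}_i$ ones, for all $i\le n$. For $I\subset[n]=\{1,\dots,n\}$ (possibly empty), $M\in\mathcal{M}_n({\bf d}^{in},{\bf d}^{out})$ and $j\le n$ put $$p^{col}_j(I,M):=|\{q\in[n]\setminus I:\ M_{qj}=1\}|,\qquad p^{row}_j(I,M):=|\{q\in[n]\setminus I:\ M_{jq}=1\}|,$$ and let $\mathcal{P}^{col}(I,M),\mathcal{P}^{row}(I,M)\in\mathbb{R}^n$ be the vectors with coordinates $$\mathcal{P}^{col}_j(I,M):=\sum_{\ell=1}^n|p^{col}_j(I,M)-p^{col}_\ell(I,M)|,\qquad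 \mathcal{P}^{row}_j(I,M):=\sum_{\ell=1}^n|p^{row}_j(I,M)-p^{row}_\ell(I,M)|.$$ For an integer $d$ and $R>0$ let $\mathcal{E}_{\mathcal P}(R)$ be the set of all $M\in\mathcal{M}_n({\bf d}^{in},{\bf d}^{out})$ such that $\|\mathcal{P}^{row}(I,M)\|_{\psi,n}\le R\,n\sqrt d$ and $\|\mathcal{P}^{col}(I,M)\|_{\psi,n}\le R\,n\sqrt d$ for every set $I\subset[n]$ of consecutive integers (possibly empty) with $|I|\le c_0n$. **Proposition.** For every $L\ge 1$ and every $m\in\mathbb{N}$ there is $\widetilde L=\widetilde L(L,m)>0$, depending only on $L$ and $m$, and for every $a\in(0,1)$ there is moreover $n_0=n_0(a,m,L)$, with the following property. Let $n\ge n_0$, let $d$ be an integer with $n^a\le d\le(1/2+c_0)n$, and let ${\bf d}^{in},{\bf d}^{out}$ be sequences of $n$ integers such that $$(1-c_0)d\le{\bf d}^{in}_i,\ {\bf d}^{out}_i\le d\quad\text{for all } i\le n,$$ $$\big\|({\bf d}^{in}_i-d)_{i=1}^n\big\|_{\psi,n}\le L\sqrt d,\qquad \big\|({\bf d}^{out}_i-d)_{i=1}^n\big\|_{\psi,n}\le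 L\sqrt d,$$ and $\mathcal{M}_n({\bf d}^{in},{\bf d}^{out})\neq\emptyset$. Then, for the uniform probability measure $\mathbb{P}$ on $\mathcal{M}_n({\bf d}^{in},{\bf d}^{out})$, $$\mathbb{P}\big(\mathcal{E}_{\mathcal P}(a^{-1}\widetilde L)\big)\ \ge\ 1-n^{-m}.$$ -/

import Mathlib

open Finset

/-- The Orlicz norm `‖x‖_{ψ,n} = inf {s > 0 : (1 / (e n)) * ∑ i, exp (|x i| / s) ≤ 1}` on `ℝⁿ`. -/
noncomputable def psiNorm {n : ℕ} (x : Fin n → ℝ) : ℝ :=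
  sInf {s : ℝ | 0 < s ∧ 1 / (Real.exp 1 * n) * ∑ i, Real.exp (|x i| / s) ≤ 1}

/-- The constant `c₀ = 0.001`. -/
noncomputable def cZero : ℝ := 1 / 1000

/-- The standing assumption on the degree sequences:
`(1 - c₀) d ≤ dⁱⁿ_i, dᵒᵘᵗ_i ≤ d` for all `i`, and `d ≤ (1/2 + c₀) n`. -/
def DegreeCondition {n : ℕ} (d : ℕ) (din dout : Fin n → ℕ) : Prop :=
  (∀ i, (1 - cZero) * d ≤ din i ∧ din i ≤ d) ∧
  (∀ i, (1 - cZero) * d ≤ dout i ∧ dout i ≤ d) ∧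
  (d : ℝ) ≤ (1 / 2 + cZero) * n

/-- The set `M_n(dⁱⁿ, dᵒᵘᵗ)` of adjacency matrices of directed graphs (loops allowed, no multiple
edges) with in-degree sequence `din` and out-degree sequence `dout`: the `0`-`1` matrices whose
`j`-th column has `din j` ones and whose `i`-th row has `dout i` ones. -/
def adjMatrices {n : ℕ} (din dout : Fin n → ℕ) : Set (Matrix (Fin n) (Fin n) ℕ) :=
  {M | (∀ i j, M i j = 0 ∨ M i j = 1) ∧
    (∀ j, #{i | M i j = 1} = din j) ∧ (∀ i, #{j | M i j = 1} = dout i)}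

theorem adjMatrices_finite {n : ℕ} (din dout : Fin n → ℕ) : (adjMatrices din dout).Finite := by
  have h : (Set.pi Set.univ fun _ : Fin n => Set.pi Set.univ fun _ : Fin n =>
      ({0, 1} : Set ℕ)).Finite :=
    Set.Finite.pi fun _ => Set.Finite.pi fun _ => Set.toFinite _
  refine h.subset fun M hM => ?_
  intro i _ j _
  simpa using hM.1 i j

/-- `p^col_j(I, M)`: the number of ones of the `j`-th column in the rows outside `I`.
For `M` in `adjMatrices din dout` this is `din j - #{q ∈ I | M q j = 1}`. -/
def pCol {n : ℕ} (I : Finset (Fin n)) (M : Matrix (Fin n) (Fin n) ℕ) (j : Fin n) : ℕ :=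
  #{q | q ∉ I ∧ M q j = 1}

/-- `p^row_j(I, M)`: the number of ones of the `j`-th row in the columns outside `I`.
For `M` in `adjMatrices din dout` this is `dout j - #{q ∈ I | M j q = 1}`. -/
def pRow {n : ℕ} (I : Finset (Fin n)) (M : Matrix (Fin n) (Fin n) ℕ) (j : Fin n) : ℕ :=
  #{q | q ∉ I ∧ M j q = 1}

/-- The vector `P^col(I, M)`. -/
def vecPCol {n : ℕ} (I : Finset (Fin n)) (M : Matrix (Fin n) (Fin n) ℕ) (j : Fin n) : ℝ :=
  ∑ l, |(pCol I M j : ℝ) - (pCol I M l : ℝ)|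

/-- The vector `P^row(I, M)`. -/
def vecPRow {n : ℕ} (I : Finset (Fin n)) (M : Matrix (Fin n) (Fin n) ℕ) (j : Fin n) : ℝ :=
  ∑ l, |(pRow I M j : ℝ) - (pRow I M l : ℝ)|

/-- The event `E_P(R)`: all matrices `M` in `M_n(dⁱⁿ, dᵒᵘᵗ)` such that for every (possibly empty)
set `I` of consecutive indices with `|I| ≤ c₀ n` both `P^row(I, M)` and `P^col(I, M)` have
`ψ`-norm at most `R n √d`. -/
def eventP {n : ℕ} (d : ℕ) (din dout : Fin n → ℕ) (R : ℝ) : Set (Matrix (Fin n) (Fin n) ℕ) :=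
  {M | M ∈ adjMatrices din dout ∧
    ∀ I : Finset (Fin n), (I : Set (Fin n)).OrdConnected → (#I : ℝ) ≤ cZero * n →
      psiNorm (vecPRow I M) ≤ R * n * √(d : ℝ) ∧ psiNorm (vecPCol I M) ≤ R * n * √(d : ℝ)}

/-- The probability of the event `E` under the normalized counting measure on the finite non-empty
set `S`. -/
noncomputable def uniformProb {Ω : Type*} (S E : Set Ω) : ℝ :=
  ((S ∩ E).ncard : ℝ) / (S.ncard : ℝ)

/-!
Let `δ_i = d - dᵒᵘᵗ_i` and, for a set `I` of rows, let `D_j` (`colDev`) be the number of ones of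
the `j`-th column in the rows of `I` minus `|I| dⁱⁿ_j / n`. As `p^col_j = (1 - |I|/n) dⁱⁿ_j - D_j`,
the coordinates of `P^col` are controlled by the deficits of the column sums, whose Orlicz norm is
bounded by assumption, and by the `D_j`. So it suffices to show that, with probability
`1 - O(n^{-m-5})` for each `I`, the vector `D` has Orlicz norm of order `√d`. There are `O(n²)`
intervals, and rows are treated by transposing.

*Switchings.* Exchange the entries of two rows `i`, `k` in two columns where they form a `2 × 2`
permutation matrix, with weight `2 / S`, where `S` (`rowSymm`) is the size of the symmetric
difference of the rows. This is reversible for the uniform measure, and since `S` does not change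
under the switching, the drift of a linear statistic is exactly linear up to a term proportional to
`dᵒᵘᵗ_i - dᵒᵘᵗ_k` (`sum_switch_drift`). Chatterjee's method of exchangeable pairs then yields the
inequality `sum_exp_drift_le` for exponential moments; a bound `μ` for the mean tilted by
`exp (θ f)` gives `E exp (θ f) ≤ exp (θ μ)` (`sum_exp_le_of_tilted_mean`). It is applied to three
statistics.

* The overlap of two rows is at most `0.6 d` up to probability `exp (-c d)`, so that `S ≥ d / 2`.
* The sums `∑ i, δ_i M_ij` are `O(d √d)` up to probability `exp (-c d / log n)`; here the
  non-linear term of the drift has a favourable sign.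
* For a set `J` of columns and `f = ± ∑ j ∈ J, D_j`, switching rows of `I` with rows outside `I` has
  drift `n f` up to an error which is `O(n |J| √d)` on the matrices satisfying the two previous
  bounds (`IsTypical`). Hence `E exp (λ f / √d) ≤ exp (|J| / 10) + 1` for small `λ` and `|J|` up to a
  multiple of `log n`; the polynomial lower bound on `d` makes the contribution of the other matrices
  negligible (`DenseRegime.sum_exp_colDev_le`).

*From moments to the Orlicz norm.* The third bound for `|J| = 1` and Markov's inequality show
that, for `λ` smaller by a factor of order `m`, no `exp (λ |D_j| / √d)` exceeds `√n`. Then the `p`-th power of `∑ j, exp (± λ D_j / √d)`, with `p` of order `log n`, is essentially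
the sum over `p`-tuples of distinct columns (`pow_le_sum_injective`), whose expectation the third
bound controls; Markov's inequality gives polynomially small probability (`card_large_sum_le`).
-/

/-! ### Switchings -/

section Switching

variable {n : ℕ}

/-- The indicator that the `j`-th column has a one in row `i` and a zero in row `k`. -/
def rowDiff (M : Matrix (Fin n) (Fin n) ℕ) (i k j : Fin n) : ℝ :=
  (M i j : ℝ) * (1 - (M k j : ℝ))

/-- The size of the symmetric difference of the supports of the rows `i` and `k`. -/
def rowSymm (M : Matrix (Fin n) (Fin n) ℕ) (i k : Fin n) : ℝ :=
  ∑ j, (rowDiff M i k j + rowDiff M k i j)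

/-- Exchange the entries of the rows `i` and `k` inside the columns `j` and `l`. -/
def switch (M : Matrix (Fin n) (Fin n) ℕ) (i k j l : Fin n) : Matrix (Fin n) (Fin n) ℕ :=
  fun p q => if q = j ∨ q = l then M (Equiv.swap i k p) q else M p q

theorem switch_switch (M : Matrix (Fin n) (Fin n) ℕ) (i k j l : Fin n) :
    switch (switch M i k j l) i k j l = M := by
  funext p q
  by_cases h : q = j ∨ q = l <;> simp [switch, h]

theorem switch_comm (M : Matrix (Fin n) (Fin n) ℕ) (i k j l : Fin n) :
    switch M i k l j = switch M i k j l := by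
  funext p q
  simp [switch, or_comm]

/-- The finset of the matrices with given column and row sums. -/
noncomputable def adjFinset (din dout : Fin n → ℕ) : Finset (Matrix (Fin n) (Fin n) ℕ) :=
  (adjMatrices_finite din dout).toFinset

variable {din dout : Fin n → ℕ} {M : Matrix (Fin n) (Fin n) ℕ}

theorem mem_adjFinset : M ∈ adjFinset din dout ↔ M ∈ adjMatrices din dout := by
  simp [adjFinset]

theorem entry_eq (hM : M ∈ adjFinset din dout) (i j : Fin n) :
    (M i j : ℝ) = 0 ∨ (M i j : ℝ) = 1 := by
  rcases (mem_adjFinset.1 hM).1 i j with h | h <;> simp [h]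

theorem card_ones_eq_sum {ι : Type*} [Fintype ι] (v : ι → ℕ) (hv : ∀ i, v i = 0 ∨ v i = 1)
    (s : Finset ι) : (#{i ∈ s | v i = 1} : ℝ) = ∑ i ∈ s, (v i : ℝ) := by
  rw [card_filter, Nat.cast_sum]
  refine sum_congr rfl fun i _ => ?_
  rcases hv i with h | h <;> simp [h]

theorem sum_row (hM : M ∈ adjFinset din dout) (i : Fin n) : ∑ j, (M i j : ℝ) = dout i := by
  have h := mem_adjFinset.1 hM
  rw [← h.2.2 i, card_ones_eq_sum _ (h.1 i)]

theorem sum_col (hM : M ∈ adjFinset din dout) (j : Fin n) : ∑ i, (M i j : ℝ) = din j := by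
  have h := mem_adjFinset.1 hM
  rw [← h.2.1 j, card_ones_eq_sum _ (fun i => h.1 i j)]

theorem entry_nonneg (M : Matrix (Fin n) (Fin n) ℕ) (i j : Fin n) : (0 : ℝ) ≤ M i j :=
  Nat.cast_nonneg _

theorem entry_le_one (hM : M ∈ adjFinset din dout) (i j : Fin n) : (M i j : ℝ) ≤ 1 := by
  rcases entry_eq hM i j with h | h <;> simp [h]

theorem rowDiff_nonneg (hM : M ∈ adjFinset din dout) (i k j : Fin n) : 0 ≤ rowDiff M i k j :=
  mul_nonneg (entry_nonneg ..) (sub_nonneg.2 (entry_le_one hM ..))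

theorem rowDiff_add_le (M : Matrix (Fin n) (Fin n) ℕ) (i k j : Fin n) :
    rowDiff M i k j + rowDiff M k i j ≤ M i j + M k j := by
  unfold rowDiff
  nlinarith [mul_nonneg (entry_nonneg M i j) (entry_nonneg M k j)]

theorem rowDiff_add_nonneg (hM : M ∈ adjFinset din dout) (i k j : Fin n) :
    0 ≤ rowDiff M i k j + rowDiff M k i j :=
  add_nonneg (rowDiff_nonneg hM ..) (rowDiff_nonneg hM ..)

theorem rowDiff_add_le_one (hM : M ∈ adjFinset din dout) (i k j : Fin n) :
    rowDiff M i k j + rowDiff M k i j ≤ 1 := by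
  unfold rowDiff
  rcases entry_eq hM i j with h | h <;> rcases entry_eq hM k j with h' | h' <;> simp [h, h']

theorem rowDiff_sub (M : Matrix (Fin n) (Fin n) ℕ) (i k j : Fin n) :
    rowDiff M i k j - rowDiff M k i j = M i j - M k j := by
  unfold rowDiff; ring

theorem rowSymm_nonneg (hM : M ∈ adjFinset din dout) (i k : Fin n) : 0 ≤ rowSymm M i k :=
  sum_nonneg fun _ _ => rowDiff_add_nonneg hM ..

/-- Switching preserves all row and column sums when columns `j`, `l` form a `2 × 2` permutation
matrix with rows `i`, `k`. -/
theorem switch_mem (hM : M ∈ adjFinset din dout) {i k j l : Fin n} (h1 : M i j = 1)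
    (h2 : M k j = 0) (h3 : M i l = 0) (h4 : M k l = 1) :
    switch M i k j l ∈ adjFinset din dout := by
  have h := mem_adjFinset.1 hM
  have hjl : j ≠ l := by rintro rfl; omega
  have h01 : ∀ p q, switch M i k j l p q = 0 ∨ switch M i k j l p q = 1 := by
    intro p q
    unfold switch
    split_ifs
    · exact h.1 _ _
    · exact h.1 _ _
  refine mem_adjFinset.2 ⟨h01, fun q => ?_, fun p => ?_⟩
  · have : (#{p | switch M i k j l p q = 1} : ℝ) = din q := by
      rw [card_ones_eq_sum _ (fun p => h01 p q), ← sum_col hM q]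
      by_cases hq : q = j ∨ q = l
      · simp only [switch, hq, if_true]
        exact Equiv.sum_comp (Equiv.swap i k) (fun p => (M p q : ℝ))
      · simp [switch, hq]
    exact_mod_cast this
  · have : (#{q | switch M i k j l p q = 1} : ℝ) = dout p := by
      rw [card_ones_eq_sum _ (h01 p), ← sum_row hM p, ← sub_eq_zero, ← sum_sub_distrib]
      have hz : ∀ q, q ≠ j ∧ q ≠ l →
          ((switch M i k j l p q : ℕ) : ℝ) - (M p q : ℝ) = 0 := by
        rintro q ⟨ha, hb⟩
        simp [switch, ha, hb]
      rw [Fintype.sum_eq_add j l hjl hz]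
      by_cases hpi : p = i
      · subst hpi; simp [switch, h1, h2, h3, h4]
      by_cases hpk : p = k
      · subst hpk; simp [switch, h1, h2, h3, h4]
      · simp [switch, Equiv.swap_apply_of_ne_of_ne hpi hpk]
    exact_mod_cast this

theorem switch_self_left (M : Matrix (Fin n) (Fin n) ℕ) (i k j l : Fin n) :
    switch M i k j l i j = M k j := by simp [switch]

theorem switch_self_right (M : Matrix (Fin n) (Fin n) ℕ) (i k j l : Fin n) :
    switch M i k j l i l = M k l := by simp [switch]

theorem switch_other_left (M : Matrix (Fin n) (Fin n) ℕ) (i k j l : Fin n) :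
    switch M i k j l k j = M i j := by simp [switch]

theorem switch_other_right (M : Matrix (Fin n) (Fin n) ℕ) (i k j l : Fin n) :
    switch M i k j l k l = M i l := by simp [switch]

theorem switch_apply_of_ne (M : Matrix (Fin n) (Fin n) ℕ) {i k p : Fin n} (hi : p ≠ i)
    (hk : p ≠ k) (j l q : Fin n) : switch M i k j l p q = M p q := by
  simp [switch, Equiv.swap_apply_of_ne_of_ne hi hk]

theorem switch_apply_of_ne_col (M : Matrix (Fin n) (Fin n) ℕ) {j l q : Fin n} (hj : q ≠ j)
    (hl : q ≠ l) (i k p : Fin n) : switch M i k j l p q = M p q := by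
  simp [switch, hj, hl]

theorem rowSymm_switch (M : Matrix (Fin n) (Fin n) ℕ) (i k j l : Fin n) :
    rowSymm (switch M i k j l) i k = rowSymm M i k := by
  unfold rowSymm
  refine sum_congr rfl fun q _ => ?_
  by_cases hq : q = j ∨ q = l
  · simp only [rowDiff, switch, hq, if_true, Equiv.swap_apply_left, Equiv.swap_apply_right]
    ring
  · simp [rowDiff, switch, hq]

theorem rowDiff_mul_ne_zero (hM : M ∈ adjFinset din dout) {i k j l : Fin n}
    (h : rowDiff M i k j * rowDiff M k i l ≠ 0) :
    M i j = 1 ∧ M k j = 0 ∧ M i l = 0 ∧ M k l = 1 := by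
  have h0 := (mem_adjFinset.1 hM).1
  unfold rowDiff at h
  rcases h0 i j with h1 | h1 <;> rcases h0 k j with h2 | h2 <;> rcases h0 i l with h3 | h3 <;>
    rcases h0 k l with h4 | h4 <;> simp_all

/-- Reversibility of switching: the map that switches columns `j` and `l` is a bijection from the
matrices with pattern `(1 0; 0 1)` onto those with pattern `(0 1; 1 0)`. -/
theorem sum_switch_single (din dout : Fin n → ℕ) (i k j l : Fin n)
    (F : Matrix (Fin n) (Fin n) ℕ → Matrix (Fin n) (Fin n) ℕ → ℝ) :
    ∑ M ∈ adjFinset din dout,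
        rowDiff M i k j * rowDiff M k i l / rowSymm M i k * F M (switch M i k j l) =
      ∑ M ∈ adjFinset din dout,
        rowDiff M i k l * rowDiff M k i j / rowSymm M i k * F (switch M i k l j) M := by
  refine sum_bij_ne_zero (fun M _ _ => switch M i k j l) ?_ ?_ ?_ ?_
  · intro M hM hne
    have hne' : rowDiff M i k j * rowDiff M k i l ≠ 0 := by
      intro h0; simp [h0] at hne
    obtain ⟨h1, h2, h3, h4⟩ := rowDiff_mul_ne_zero hM hne'
    exact switch_mem hM h1 h2 h3 h4
  · intro M₁ _ _ M₂ _ _ h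
    rw [← switch_switch M₁ i k j l, h, switch_switch]
  · intro M hM hne
    have hne' : rowDiff M i k l * rowDiff M k i j ≠ 0 := by
      intro h0; simp [h0] at hne
    obtain ⟨h1, h2, h3, h4⟩ := rowDiff_mul_ne_zero hM hne'
    refine ⟨switch M i k l j, switch_mem hM h1 h2 h3 h4, ?_, ?_⟩
    · rw [switch_comm M i k j l] at hne ⊢
      rw [rowSymm_switch, switch_switch]
      simpa [rowDiff, switch_self_left, switch_self_right, switch_other_left,
        switch_other_right, h1, h2, h3, h4] using hne
    · rw [switch_comm, switch_switch]
  · intro M hM hne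
    have hne' : rowDiff M i k j * rowDiff M k i l ≠ 0 := by
      intro h0; simp [h0] at hne
    obtain ⟨h1, h2, h3, h4⟩ := rowDiff_mul_ne_zero hM hne'
    rw [rowSymm_switch, switch_comm, switch_switch]
    simp [rowDiff, switch_self_left, switch_self_right, switch_other_left,
        switch_other_right, h1, h2, h3, h4]

theorem sum_switch (din dout : Fin n → ℕ) (i k : Fin n)
    (F : Matrix (Fin n) (Fin n) ℕ → Matrix (Fin n) (Fin n) ℕ → ℝ) :
    ∑ M ∈ adjFinset din dout, ∑ j, ∑ l,
        rowDiff M i k j * rowDiff M k i l / rowSymm M i k * F M (switch M i k j l) =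
      ∑ M ∈ adjFinset din dout, ∑ j, ∑ l,
        rowDiff M i k j * rowDiff M k i l / rowSymm M i k * F (switch M i k j l) M := by
  have h : ∀ G : Matrix (Fin n) (Fin n) ℕ → Fin n → Fin n → ℝ,
      ∑ M ∈ adjFinset din dout, ∑ j, ∑ l, G M j l =
        ∑ j, ∑ l, ∑ M ∈ adjFinset din dout, G M j l := by
    intro G
    rw [sum_comm]
    exact sum_congr rfl fun j _ => sum_comm
  rw [h, h, sum_comm]
  exact sum_congr rfl fun l _ => sum_congr rfl fun j _ => sum_switch_single din dout i k j l F

end Switching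

/-! ### Exponential moments along a reversible switching chain -/

section ExpMoment

theorem sub_mul_exp_sub_le (x y : ℝ) :
    (x - y) * (Real.exp x - Real.exp y) ≤ (x - y) ^ 2 * (Real.exp x + Real.exp y) := by
  have key : ∀ x y : ℝ, y ≤ x →
      (x - y) * (Real.exp x - Real.exp y) ≤ (x - y) ^ 2 * (Real.exp x + Real.exp y) := by
    intro x y h
    have h1 : Real.exp x - Real.exp y ≤ (x - y) * Real.exp x := by
      have h2 := Real.add_one_le_exp (y - x)
      have h3 : Real.exp y = Real.exp (y - x) * Real.exp x := by rw [← Real.exp_add]; ring_nf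
      nlinarith [Real.exp_pos x]
    have h4 := mul_le_mul_of_nonneg_left h1 (sub_nonneg.2 h)
    nlinarith [mul_nonneg (sq_nonneg (x - y)) (Real.exp_pos y).le]
  rcases le_total y x with h | h
  · exact key x y h
  · have := key y x h
    nlinarith

variable {n : ℕ} {din dout : Fin n → ℕ}

theorem sum_rowDiff_sub (M : Matrix (Fin n) (Fin n) ℕ) (hM : M ∈ adjFinset din dout)
    (i k : Fin n) :
    ∑ j, rowDiff M i k j - ∑ j, rowDiff M k i j = (dout i : ℝ) - dout k := by
  rw [← sum_sub_distrib, ← sum_row hM i, ← sum_row hM k, ← sum_sub_distrib]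
  exact sum_congr rfl fun j _ => rowDiff_sub M i k j

/-- The first-order effect of a random switching of the rows `i` and `k`, weighted by
`2 / rowSymm M i k`, on a statistic with increments `V j - V l`. The weight is chosen so that
the leading part is the linear form `∑ j, V j * (M i j - M k j)`. -/
theorem sum_switch_drift {M : Matrix (Fin n) (Fin n) ℕ} (hM : M ∈ adjFinset din dout)
    (i k : Fin n) (V : Fin n → ℝ) :
    2 * ∑ j, ∑ l, rowDiff M i k j * rowDiff M k i l / rowSymm M i k * (V j - V l) =
      ∑ j, V j * ((M i j : ℝ) - M k j) -
        ((dout i : ℝ) - dout k) / rowSymm M i k *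
          ∑ j, V j * (rowDiff M i k j + rowDiff M k i j) := by
  have hs : rowSymm M i k = ∑ j, rowDiff M i k j + ∑ j, rowDiff M k i j := sum_add_distrib
  have hd := sum_rowDiff_sub M hM i k
  have e1 : ∑ j, ∑ l, rowDiff M i k j * rowDiff M k i l / rowSymm M i k * (V j - V l) =
      ((∑ j, V j * rowDiff M i k j) * ∑ l, rowDiff M k i l -
        (∑ j, rowDiff M i k j) * ∑ l, V l * rowDiff M k i l) / rowSymm M i k := by
    rw [sum_mul_sum, sum_mul_sum, ← sum_sub_distrib, sum_div]
    refine sum_congr rfl fun j _ => ?_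
    rw [← sum_sub_distrib, sum_div]
    exact sum_congr rfl fun l _ => by ring
  have e2 : ∑ j, V j * ((M i j : ℝ) - M k j) =
      ∑ j, V j * rowDiff M i k j - ∑ j, V j * rowDiff M k i j := by
    rw [← sum_sub_distrib]
    exact sum_congr rfl fun j _ => by rw [← rowDiff_sub]; ring
  have e3 : ∑ j, V j * (rowDiff M i k j + rowDiff M k i j) =
      ∑ j, V j * rowDiff M i k j + ∑ j, V j * rowDiff M k i j := by
    rw [← sum_add_distrib]
    exact sum_congr rfl fun j _ => by ring
  rw [e1, e2, e3, ← hd]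
  by_cases h0 : rowSymm M i k = 0
  · have hz := (sum_eq_zero_iff_of_nonneg fun j _ => rowDiff_add_nonneg hM i k j).1 h0
    have ha : ∀ j, rowDiff M i k j = 0 := fun j => by
      linarith [hz j (mem_univ _), rowDiff_nonneg hM i k j, rowDiff_nonneg hM k i j]
    have hb : ∀ j, rowDiff M k i j = 0 := fun j => by
      linarith [hz j (mem_univ _), rowDiff_nonneg hM i k j, rowDiff_nonneg hM k i j]
    simp [ha, hb]
  · field_simp
    rw [hs]
    ring

theorem sum_switch_sq_le {M : Matrix (Fin n) (Fin n) ℕ} (hM : M ∈ adjFinset din dout)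
    (i k : Fin n) (V : Fin n → ℝ) :
    ∑ j, ∑ l, rowDiff M i k j * rowDiff M k i l / rowSymm M i k * (V j - V l) ^ 2 ≤
      2 * ∑ j, V j ^ 2 * (rowDiff M i k j + rowDiff M k i j) := by
  have hs : rowSymm M i k = ∑ j, rowDiff M i k j + ∑ j, rowDiff M k i j := sum_add_distrib
  have hA : 0 ≤ ∑ j, rowDiff M i k j := sum_nonneg fun j _ => rowDiff_nonneg hM i k j
  have hB : 0 ≤ ∑ j, rowDiff M k i j := sum_nonneg fun j _ => rowDiff_nonneg hM k i j
  have hVA : 0 ≤ ∑ j, V j ^ 2 * rowDiff M i k j :=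
    sum_nonneg fun j _ => mul_nonneg (sq_nonneg _) (rowDiff_nonneg hM i k j)
  have hVB : 0 ≤ ∑ j, V j ^ 2 * rowDiff M k i j :=
    sum_nonneg fun j _ => mul_nonneg (sq_nonneg _) (rowDiff_nonneg hM k i j)
  have e1 : ∑ j, ∑ l, rowDiff M i k j * rowDiff M k i l / rowSymm M i k * (V j - V l) ^ 2 ≤
      2 * ((∑ j, V j ^ 2 * rowDiff M i k j) * ∑ l, rowDiff M k i l +
        (∑ j, rowDiff M i k j) * ∑ l, V l ^ 2 * rowDiff M k i l) / rowSymm M i k := by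
    rw [sum_mul_sum, sum_mul_sum, ← sum_add_distrib, mul_sum, sum_div]
    refine sum_le_sum fun j _ => ?_
    rw [← sum_add_distrib, mul_sum, sum_div]
    refine sum_le_sum fun l _ => ?_
    have h1 : 0 ≤ rowDiff M i k j * rowDiff M k i l / rowSymm M i k :=
      div_nonneg (mul_nonneg (rowDiff_nonneg hM ..) (rowDiff_nonneg hM ..)) (rowSymm_nonneg hM ..)
    calc _ ≤ rowDiff M i k j * rowDiff M k i l / rowSymm M i k * (2 * (V j ^ 2 + V l ^ 2)) := by
          gcongr; nlinarith [sq_nonneg (V j + V l)]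
      _ = _ := by ring
  have e3 : ∑ j, V j ^ 2 * (rowDiff M i k j + rowDiff M k i j) =
      ∑ j, V j ^ 2 * rowDiff M i k j + ∑ j, V j ^ 2 * rowDiff M k i j := by
    rw [← sum_add_distrib]
    exact sum_congr rfl fun j _ => by ring
  refine e1.trans ?_
  rw [e3]
  refine div_le_of_le_mul₀ (rowSymm_nonneg hM i k) (by positivity) ?_
  rw [hs]
  nlinarith [mul_nonneg hA hVA, mul_nonneg hB hVB]

/-- The basic exponential inequality: reversibility turns the drift of `f` along switchings of the
rows `i` and `k`, tested against `exp (θ f)`, into a variance term. -/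
theorem sum_exp_drift_le {θ : ℝ} (hθ : 0 ≤ θ) (f : Matrix (Fin n) (Fin n) ℕ → ℝ)
    (V : Matrix (Fin n) (Fin n) ℕ → Fin n → ℝ) (i k : Fin n)
    (hf : ∀ M ∈ adjFinset din dout, ∀ j l, M i j = 1 → M k j = 0 → M i l = 0 → M k l = 1 →
      f M - f (switch M i k j l) = V M j - V M l) :
    ∑ M ∈ adjFinset din dout, Real.exp (θ * f M) *
        (∑ j, V M j * ((M i j : ℝ) - M k j) -
          ((dout i : ℝ) - dout k) / rowSymm M i k *
            ∑ j, V M j * (rowDiff M i k j + rowDiff M k i j)) ≤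
      4 * θ * ∑ M ∈ adjFinset din dout, Real.exp (θ * f M) *
        ∑ j, V M j ^ 2 * (rowDiff M i k j + rowDiff M k i j) := by
  set w : Matrix (Fin n) (Fin n) ℕ → Fin n → Fin n → ℝ :=
    fun M j l => rowDiff M i k j * rowDiff M k i l / rowSymm M i k with hw
  have hw0 : ∀ M ∈ adjFinset din dout, ∀ j l, 0 ≤ w M j l := fun M hM j l =>
    div_nonneg (mul_nonneg (rowDiff_nonneg hM ..) (rowDiff_nonneg hM ..)) (rowSymm_nonneg hM ..)
  have hwV : ∀ M ∈ adjFinset din dout, ∀ j l, ∀ φ : ℝ → ℝ,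
      w M j l * φ (V M j - V M l) = w M j l * φ (f M - f (switch M i k j l)) := by
    intro M hM j l φ
    by_cases h0 : rowDiff M i k j * rowDiff M k i l = 0
    · simp [hw, h0]
    · obtain ⟨h1, h2, h3, h4⟩ := rowDiff_mul_ne_zero hM h0
      rw [hf M hM j l h1 h2 h3 h4]
  -- symmetrize the drift term
  have hdrift : ∑ M ∈ adjFinset din dout, Real.exp (θ * f M) *
        (∑ j, V M j * ((M i j : ℝ) - M k j) -
          ((dout i : ℝ) - dout k) / rowSymm M i k *
            ∑ j, V M j * (rowDiff M i k j + rowDiff M k i j)) =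
      2 * ∑ M ∈ adjFinset din dout, ∑ j, ∑ l, w M j l *
        ((f M - f (switch M i k j l)) * Real.exp (θ * f M)) := by
    rw [mul_sum]
    refine sum_congr rfl fun M hM => ?_
    rw [← sum_switch_drift hM, mul_left_comm, mul_sum]
    congr 1
    refine sum_congr rfl fun j _ => ?_
    rw [mul_sum]
    refine sum_congr rfl fun l _ => ?_
    have := hwV M hM j l id
    simp only [id, hw] at this ⊢
    linear_combination Real.exp (θ * f M) * this
  have hrev := sum_switch din dout i k fun M M' => (f M - f M') * Real.exp (θ * f M)
  have hrev2 := sum_switch din dout i k fun M M' => (f M - f M') ^ 2 * Real.exp (θ * f M)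
  have hsq : ∑ M ∈ adjFinset din dout, ∑ j, ∑ l, w M j l *
        ((f M - f (switch M i k j l)) ^ 2 * Real.exp (θ * f M)) ≤
      2 * ∑ M ∈ adjFinset din dout, Real.exp (θ * f M) *
        ∑ j, V M j ^ 2 * (rowDiff M i k j + rowDiff M k i j) := by
    rw [mul_sum]
    refine sum_le_sum fun M hM => ?_
    rw [mul_left_comm]
    refine le_trans (le_of_eq ?_)
      (mul_le_mul_of_nonneg_left (sum_switch_sq_le hM i k (V M)) (Real.exp_pos _).le)
    rw [mul_sum]
    refine sum_congr rfl fun j _ => ?_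
    rw [mul_sum]
    refine sum_congr rfl fun l _ => ?_
    have := hwV M hM j l (fun x => x ^ 2)
    simp only [hw] at this ⊢
    linear_combination -Real.exp (θ * f M) * this
  have hpt : ∑ M ∈ adjFinset din dout, ∑ j, ∑ l, w M j l *
        ((f M - f (switch M i k j l)) * Real.exp (θ * f M)) +
      ∑ M ∈ adjFinset din dout, ∑ j, ∑ l, w M j l *
        ((f (switch M i k j l) - f M) * Real.exp (θ * f (switch M i k j l))) ≤
      θ * (∑ M ∈ adjFinset din dout, ∑ j, ∑ l, w M j l *
        ((f M - f (switch M i k j l)) ^ 2 * Real.exp (θ * f M)) +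
      ∑ M ∈ adjFinset din dout, ∑ j, ∑ l, w M j l *
        ((f (switch M i k j l) - f M) ^ 2 * Real.exp (θ * f (switch M i k j l)))) := by
    simp only [← sum_add_distrib, mul_sum]
    refine sum_le_sum fun M hM => sum_le_sum fun j _ => sum_le_sum fun l _ => ?_
    set x := f M
    set y := f (switch M i k j l)
    have h1 : (x - y) * Real.exp (θ * x) + (y - x) * Real.exp (θ * y) ≤
        θ * ((x - y) ^ 2 * Real.exp (θ * x) + (y - x) ^ 2 * Real.exp (θ * y)) := by
      rcases hθ.eq_or_lt with rfl | hpos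
      · simp
      · have := sub_mul_exp_sub_le (θ * x) (θ * y)
        refine le_of_mul_le_mul_left ?_ hpos
        nlinarith
    have := mul_le_mul_of_nonneg_left h1 (hw0 M hM j l)
    linarith
  rw [hdrift]
  simp only [hw] at hpt hsq ⊢
  rw [← hrev, ← hrev2] at hpt
  have := mul_le_mul_of_nonneg_left hsq hθ
  linarith

/-- A tilted mean at most `μ` bounds the exponential moment. -/
theorem sum_exp_le_of_tilted_mean {Ω : Type*} (s : Finset Ω) (f : Ω → ℝ) {θ μ η : ℝ} (hθ : 0 ≤ θ)
    (h : ∑ x ∈ s, (f x - μ) * Real.exp (θ * f x) ≤ η) :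
    ∑ x ∈ s, Real.exp (θ * f x) ≤ #s * Real.exp (θ * μ) + θ * η := by
  have h1 : ∀ x ∈ s, Real.exp (θ * f x) - Real.exp (θ * μ) ≤
      θ * ((f x - μ) * Real.exp (θ * f x)) := by
    intro x _
    have h2 := Real.add_one_le_exp (θ * μ - θ * f x)
    have h3 : Real.exp (θ * μ) = Real.exp (θ * μ - θ * f x) * Real.exp (θ * f x) := by
      rw [← Real.exp_add]; ring_nf
    nlinarith [Real.exp_pos (θ * f x)]
  have h4 := sum_le_sum h1
  rw [← mul_sum, sum_sub_distrib, sum_const, nsmul_eq_mul] at h4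
  have := mul_le_mul_of_nonneg_left h hθ
  linarith

/-- Chernoff's bound for the counting measure. -/
theorem card_filter_le_of_sum_exp_le {Ω : Type*} (s : Finset Ω) (f : Ω → ℝ) {θ t B : ℝ}
    (hθ : 0 ≤ θ) (h : ∑ x ∈ s, Real.exp (θ * f x) ≤ B) :
    (#{x ∈ s | t ≤ f x} : ℝ) ≤ B * Real.exp (-(θ * t)) := by
  rw [Real.exp_neg, ← div_eq_mul_inv, le_div_iff₀ (Real.exp_pos _)]
  calc (#{x ∈ s | t ≤ f x} : ℝ) * Real.exp (θ * t)
      = ∑ x ∈ s with t ≤ f x, Real.exp (θ * t) := by rw [sum_const, nsmul_eq_mul]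
    _ ≤ ∑ x ∈ s with t ≤ f x, Real.exp (θ * f x) := by
        refine sum_le_sum fun x hx => ?_
        have := (mem_filter.1 hx).2
        gcongr
    _ ≤ ∑ x ∈ s, Real.exp (θ * f x) :=
        sum_le_sum_of_subset_of_nonneg (filter_subset _ _) fun _ _ _ => (Real.exp_pos _).le
    _ ≤ B := h

end ExpMoment

/-! ### Overlaps of rows and weighted column sums -/

section Statistics

variable {n : ℕ} {din dout : Fin n → ℕ}

/-- The increment of a linear statistic under a switching. -/
theorem linear_sub_switch (W : Fin n → Fin n → ℝ) {M : Matrix (Fin n) (Fin n) ℕ}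
    {i k j l : Fin n} (h1 : M i j = 1) (h2 : M k j = 0) (h3 : M i l = 0) (h4 : M k l = 1) :
    ∑ q, ∑ p, W p q * (M p q : ℝ) - ∑ q, ∑ p, W p q * (switch M i k j l p q : ℝ) =
      (W i j - W k j) - (W i l - W k l) := by
  have hjl : j ≠ l := by rintro rfl; omega
  have hik : i ≠ k := by rintro rfl; omega
  simp only [← sum_sub_distrib]
  rw [Fintype.sum_eq_add j l hjl]
  · rw [Fintype.sum_eq_add i k hik, Fintype.sum_eq_add i k hik]
    · rw [switch_self_left, switch_self_right, switch_other_left, switch_other_right,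
        h1, h2, h3, h4]
      push_cast; ring
    · rintro p ⟨ha, hb⟩
      rw [switch_apply_of_ne M ha hb, sub_self]
    · rintro p ⟨ha, hb⟩
      rw [switch_apply_of_ne M ha hb, sub_self]
  · rintro q ⟨ha, hb⟩
    refine sum_eq_zero fun p _ => ?_
    rw [switch_apply_of_ne_col M ha hb, sub_self]

theorem abs_sub_le_rowSymm {M : Matrix (Fin n) (Fin n) ℕ} (hM : M ∈ adjFinset din dout)
    (i k : Fin n) : |(dout i : ℝ) - dout k| ≤ rowSymm M i k := by
  have hs : rowSymm M i k = ∑ j, rowDiff M i k j + ∑ j, rowDiff M k i j := sum_add_distrib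
  have hA : 0 ≤ ∑ j, rowDiff M i k j := sum_nonneg fun j _ => rowDiff_nonneg hM i k j
  have hB : 0 ≤ ∑ j, rowDiff M k i j := sum_nonneg fun j _ => rowDiff_nonneg hM k i j
  rw [← sum_rowDiff_sub M hM i k, hs, abs_le]
  constructor <;> linarith

theorem abs_div_rowSymm_le {M : Matrix (Fin n) (Fin n) ℕ} (hM : M ∈ adjFinset din dout)
    (i k : Fin n) : |((dout i : ℝ) - dout k) / rowSymm M i k| ≤ 1 := by
  rw [abs_div, abs_of_nonneg (rowSymm_nonneg hM i k)]
  exact div_le_one_of_le₀ (abs_sub_le_rowSymm hM i k) (rowSymm_nonneg hM i k)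

/-- The number of common ones of two rows. -/
def rowOverlap (M : Matrix (Fin n) (Fin n) ℕ) (i r : Fin n) : ℝ :=
  ∑ q, (M i q : ℝ) * M r q

theorem rowSymm_eq {M : Matrix (Fin n) (Fin n) ℕ} (hM : M ∈ adjFinset din dout)
    (i k : Fin n) : rowSymm M i k = dout i + dout k - 2 * rowOverlap M i k := by
  rw [← sum_row hM i, ← sum_row hM k, rowOverlap, rowSymm, mul_sum, ← sum_add_distrib,
    ← sum_sub_distrib]
  exact sum_congr rfl fun j _ => by unfold rowDiff; ring

/-- The tilted mean of the overlap of two rows: resampling row `i` against all other rows while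
row `r` is kept makes the overlap revert to the value it has for a random set of columns. -/
theorem sum_exp_rowOverlap_le {d c θ : ℝ} (hθ : 0 ≤ θ) (hc : 0 ≤ c)
    (hin : ∀ j, (din j : ℝ) ≤ d) (hout : ∀ j, (dout j : ℝ) ≤ d)
    (hdiff : ∀ i k, |(dout i : ℝ) - dout k| ≤ c) {i r : Fin n}
    (hri : r ≠ i) :
    ∑ M ∈ adjFinset din dout,
      (n * rowOverlap M i r - (d ^ 2 + 2 * d + n * c + 4 * θ * n * d)) *
        Real.exp (θ * rowOverlap M i r) ≤ 0 := by
  have hd : 0 ≤ d := (Nat.cast_nonneg _).trans (hin i)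
  have key : ∀ k ∈ ({i, r} : Finset (Fin n))ᶜ,
      ∑ M ∈ adjFinset din dout, Real.exp (θ * rowOverlap M i r) *
        ((∑ j, (M r j : ℝ) * ((M i j : ℝ) - M k j)) - c) ≤
      4 * θ * ∑ M ∈ adjFinset din dout, Real.exp (θ * rowOverlap M i r) * d := by
    intro k hk
    obtain ⟨hki, hkr⟩ : k ≠ i ∧ k ≠ r := by simpa using hk
    have hdr := sum_exp_drift_le hθ (fun M => rowOverlap M i r) (fun M q => (M r q : ℝ)) i k
      (din := din) (dout := dout) (by
        intro M _ j l h1 h2 h3 h4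
        have hjl : j ≠ l := by rintro rfl; omega
        simp only [rowOverlap]
        rw [← sum_sub_distrib, Fintype.sum_eq_add j l hjl]
        · rw [switch_self_left, switch_self_right, switch_apply_of_ne M hri hkr.symm,
            switch_apply_of_ne M hri hkr.symm, h1, h2, h3, h4]
          push_cast; ring
        · rintro q ⟨ha, hb⟩
          rw [switch_apply_of_ne_col M ha hb, switch_apply_of_ne_col M ha hb, sub_self])
    refine le_trans (sum_le_sum fun M hM => ?_) (hdr.trans ?_)
    · refine mul_le_mul_of_nonneg_left (sub_le_sub_left ?_ _) (Real.exp_pos _).le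
      have h0 : 0 ≤ ∑ j, (M r j : ℝ) * (rowDiff M i k j + rowDiff M k i j) :=
        sum_nonneg fun j _ => mul_nonneg (entry_nonneg ..) (rowDiff_add_nonneg hM ..)
      have h1 : ∑ j, (M r j : ℝ) * (rowDiff M i k j + rowDiff M k i j) ≤ rowSymm M i k :=
        sum_le_sum fun j _ => mul_le_of_le_one_left (rowDiff_add_nonneg hM ..)
          (entry_le_one hM ..)
      have h2 := rowSymm_nonneg hM i k
      calc _ ≤ |(dout i : ℝ) - dout k| / rowSymm M i k * rowSymm M i k :=
            mul_le_mul (by gcongr; exact le_abs_self _) h1 h0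
              (div_nonneg (abs_nonneg _) h2)
        _ ≤ |(dout i : ℝ) - dout k| := by
            rcases h2.eq_or_lt with h | h
            · rw [← h]; simp
            · rw [div_mul_cancel₀ _ h.ne']
        _ ≤ c := hdiff i k
    · refine mul_le_mul_of_nonneg_left (sum_le_sum fun M hM => ?_) (by positivity)
      refine mul_le_mul_of_nonneg_left ?_ (Real.exp_pos _).le
      refine le_trans (sum_le_sum fun j _ => ?_) ((sum_row hM r).le.trans (hout r))
      have h1 := entry_le_one hM r j
      have h0 := entry_nonneg M r j
      have h2 := rowDiff_add_le_one hM i k j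
      have h3 := rowDiff_add_nonneg hM i k j
      nlinarith [mul_nonneg h0 h0]
  have hcard : (#(({i, r} : Finset (Fin n))ᶜ) : ℝ) ≤ n := by
    exact_mod_cast (card_le_univ _).trans (by simp)
  have hpt : ∀ M ∈ adjFinset din dout,
      n * rowOverlap M i r - (d ^ 2 + 2 * d + n * c) ≤
        ∑ k ∈ ({i, r} : Finset (Fin n))ᶜ, ((∑ j, (M r j : ℝ) * ((M i j : ℝ) - M k j)) - c) := by
    intro M hM
    have hX : ∀ k, ∑ j, (M r j : ℝ) * ((M i j : ℝ) - M k j) =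
        rowOverlap M i r - rowOverlap M k r := by
      intro k
      rw [rowOverlap, rowOverlap, ← sum_sub_distrib]
      exact sum_congr rfl fun j _ => by ring
    have hov : ∀ k, 0 ≤ rowOverlap M k r := fun k =>
      sum_nonneg fun j _ => mul_nonneg (entry_nonneg ..) (entry_nonneg ..)
    have hovd : rowOverlap M i r ≤ d := by
      refine le_trans (sum_le_sum fun j _ => ?_) ((sum_row hM r).le.trans (hout r))
      exact mul_le_of_le_one_left (entry_nonneg ..) (entry_le_one hM ..)
    have hall : ∑ k, rowOverlap M k r ≤ d * d := by
      simp only [rowOverlap]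
      rw [sum_comm]
      calc ∑ j, ∑ k, (M k j : ℝ) * M r j = ∑ j, (din j : ℝ) * M r j := by
            refine sum_congr rfl fun j _ => ?_
            rw [← sum_mul, sum_col hM]
        _ ≤ ∑ j, d * (M r j : ℝ) :=
            sum_le_sum fun j _ => mul_le_mul_of_nonneg_right (hin j) (entry_nonneg ..)
        _ = d * dout r := by rw [← mul_sum, sum_row hM]
        _ ≤ d * d := mul_le_mul_of_nonneg_left (hout r) hd
    have hsplit := sum_add_sum_compl ({i, r} : Finset (Fin n))
      (fun k => rowOverlap M i r - rowOverlap M k r)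
    have hfull : ∑ k, (rowOverlap M i r - rowOverlap M k r) =
        n * rowOverlap M i r - ∑ k, rowOverlap M k r := by
      simp [sum_sub_distrib]
    rw [sum_pair hri.symm, hfull] at hsplit
    simp only [hX]
    rw [sum_sub_distrib, sum_const, nsmul_eq_mul]
    nlinarith [hov r, hov i, mul_le_mul_of_nonneg_right hcard hc]
  have hsum := sum_le_sum key
  rw [sum_comm, sum_const, nsmul_eq_mul] at hsum
  set E := ∑ M ∈ adjFinset din dout, Real.exp (θ * rowOverlap M i r) with hE
  have hE0 : 0 ≤ E := sum_nonneg fun _ _ => (Real.exp_pos _).le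
  have h1 : ∑ M ∈ adjFinset din dout, (n * rowOverlap M i r - (d ^ 2 + 2 * d + n * c)) *
      Real.exp (θ * rowOverlap M i r) ≤ n * (4 * θ * (E * d)) := by
    refine le_trans (sum_le_sum fun M hM => ?_) (hsum.trans ?_)
    · rw [← mul_sum, mul_comm]
      exact mul_le_mul_of_nonneg_left (hpt M hM) (Real.exp_pos _).le
    · rw [← sum_mul, ← hE]
      exact mul_le_mul_of_nonneg_right hcard (by positivity)
  have h2 : ∑ M ∈ adjFinset din dout,
      (n * rowOverlap M i r - (d ^ 2 + 2 * d + n * c + 4 * θ * n * d)) *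
        Real.exp (θ * rowOverlap M i r) =
      ∑ M ∈ adjFinset din dout, (n * rowOverlap M i r - (d ^ 2 + 2 * d + n * c)) *
        Real.exp (θ * rowOverlap M i r) - 4 * θ * n * d * E := by
    rw [hE, mul_sum, ← sum_sub_distrib]
    exact sum_congr rfl fun M _ => by ring
  rw [h2]
  linarith

/-- The sum of the `j`-th column weighted by the deficits `d - dout i`. -/
def deficitSum (d : ℝ) (dout : Fin n → ℕ) (M : Matrix (Fin n) (Fin n) ℕ) (j : Fin n) : ℝ :=
  ∑ i, (d - dout i) * (M i j : ℝ)

/-- The tilted mean of a weighted column sum with weights `d - dout i`. Rows with a larger deficit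
have fewer ones, so the inhomogeneity of the row sums enters with a favourable sign. -/
theorem sum_exp_deficitSum_le {d D δ θ : ℝ} (hθ : 0 ≤ θ) (hδ : 8 * (θ * δ) ≤ 1)
    (hout : ∀ i, (dout i : ℝ) ≤ d) (hin : ∀ j, (din j : ℝ) ≤ d)
    (hmax : ∀ i, d - dout i ≤ δ) (hD : ∑ i, (d - dout i) ≤ D) (j₀ : Fin n) :
    ∑ M ∈ adjFinset din dout, (n * deficitSum d dout M j₀ - 3 * D * d) *
      Real.exp (θ * deficitSum d dout M j₀) ≤ 0 := by
  set z : Fin n → ℝ := fun i => d - dout i with hz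
  have hz0 : ∀ i, 0 ≤ z i := fun i => sub_nonneg.2 (hout i)
  have hδ0 : 0 ≤ δ := (hz0 j₀).trans (hmax j₀)
  set g : Matrix (Fin n) (Fin n) ℕ → ℝ := fun M => deficitSum d dout M j₀ with hg
  have hg_lin : ∀ M, g M = ∑ q, ∑ p, (if q = j₀ then z p else 0) * (M p q : ℝ) := by
    intro M
    simp [hg, deficitSum, hz, ite_mul, sum_ite_irrel]
  have key : ∀ i k : Fin n,
      ∑ M ∈ adjFinset din dout, Real.exp (θ * g M) *
        ((z i - z k) * ((M i j₀ : ℝ) - M k j₀)) ≤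
      4 * θ * ∑ M ∈ adjFinset din dout, Real.exp (θ * g M) *
        (δ * (z i + z k) * (M i j₀ + M k j₀)) := by
    intro i k
    have hdr := sum_exp_drift_le hθ g (fun _ q => if q = j₀ then z i - z k else 0) i k
      (din := din) (dout := dout) (by
        intro M _ j l h1 h2 h3 h4
        rw [hg_lin, hg_lin, linear_sub_switch (fun p q => if q = j₀ then z p else 0) h1 h2 h3 h4]
        split_ifs <;> ring)
    refine le_trans (sum_le_sum fun M hM => ?_) (hdr.trans ?_)
    · refine mul_le_mul_of_nonneg_left ?_ (Real.exp_pos _).le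
      simp only [ite_mul, zero_mul, sum_ite_eq', mem_univ, if_true]
      have h2 : (dout i : ℝ) - dout k = -(z i - z k) := by simp [hz]
      rw [h2]
      have h3 : 0 ≤ (z i - z k) ^ 2 / rowSymm M i k *
          (rowDiff M i k j₀ + rowDiff M k i j₀) :=
        mul_nonneg (div_nonneg (sq_nonneg _) (rowSymm_nonneg hM ..)) (rowDiff_add_nonneg hM ..)
      have h4 : -(z i - z k) / rowSymm M i k *
          ((z i - z k) * (rowDiff M i k j₀ + rowDiff M k i j₀)) =
          -((z i - z k) ^ 2 / rowSymm M i k * (rowDiff M i k j₀ + rowDiff M k i j₀)) := by ring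
      rw [h4]
      linarith
    · refine mul_le_mul_of_nonneg_left (sum_le_sum fun M hM => ?_) (by positivity)
      refine mul_le_mul_of_nonneg_left ?_ (Real.exp_pos _).le
      simp only [ite_pow, ite_mul, zero_mul, sum_ite_eq', mem_univ, if_true, ne_eq,
        OfNat.ofNat_ne_zero, not_false_eq_true, zero_pow]
      refine mul_le_mul ?_ (rowDiff_add_le M i k j₀) (rowDiff_add_nonneg hM ..)
        (mul_nonneg hδ0 (add_nonneg (hz0 i) (hz0 k)))
      have := hz0 i
      have := hz0 k
      have h5 : z i ≤ δ := hmax i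
      have h6 : z k ≤ δ := hmax k
      nlinarith
  have hsum := sum_le_sum fun i (_ : i ∈ (univ : Finset (Fin n))) =>
    sum_le_sum fun k (_ : k ∈ (univ : Finset (Fin n))) => key i k
  have hswap : ∀ H : Fin n → Fin n → Matrix (Fin n) (Fin n) ℕ → ℝ,
      ∑ i, ∑ k, ∑ M ∈ adjFinset din dout, Real.exp (θ * g M) * H i k M =
      ∑ M ∈ adjFinset din dout, Real.exp (θ * g M) * ∑ i, ∑ k, H i k M := by
    intro H
    simp only [mul_sum]
    rw [sum_comm]
    rw [sum_comm (s := adjFinset din dout)]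
    rw [sum_comm]
    exact sum_congr rfl fun i _ => sum_comm
  simp only [← mul_sum] at hsum
  rw [hswap, hswap] at hsum
  have hz_sum0 : 0 ≤ ∑ i, z i := sum_nonneg fun i _ => hz0 i
  have e1 : ∀ M ∈ adjFinset din dout,
      ∑ i, ∑ k, (z i - z k) * ((M i j₀ : ℝ) - M k j₀) =
        2 * (n * g M) - 2 * ((∑ i, z i) * din j₀) := by
    intro M hM
    have : ∀ i k, (z i - z k) * ((M i j₀ : ℝ) - M k j₀) =
      z i * M i j₀ + z k * M k j₀ - z i * M k j₀ - z k * M i j₀ := fun i k => by ring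
    simp only [this, sum_sub_distrib, sum_add_distrib, sum_const, card_univ, Fintype.card_fin,
      nsmul_eq_mul, ← mul_sum, ← sum_mul, sum_col hM]
    simp only [hg, deficitSum, hz]
    ring
  have e2 : ∀ M ∈ adjFinset din dout,
      ∑ i, ∑ k, δ * (z i + z k) * ((M i j₀ : ℝ) + M k j₀) =
        δ * (2 * (n * g M) + 2 * ((∑ i, z i) * din j₀)) := by
    intro M hM
    have : ∀ i k, δ * (z i + z k) * ((M i j₀ : ℝ) + M k j₀) =
      δ * (z i * M i j₀ + z k * M k j₀ + z i * M k j₀ + z k * M i j₀) := fun i k => by ring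
    simp only [this, ← mul_sum]
    simp only [sum_add_distrib, sum_const, card_univ, Fintype.card_fin,
      nsmul_eq_mul, ← mul_sum, ← sum_mul, sum_col hM]
    simp only [hg, deficitSum, hz]
    ring
  have f1 := sum_congr rfl fun M hM => congrArg (Real.exp (θ * g M) * ·) (e1 M hM)
  have f2 := sum_congr rfl fun M hM => congrArg (Real.exp (θ * g M) * ·) (e2 M hM)
  rw [f1, f2] at hsum
  rw [mul_sum, ← sub_nonpos, ← sum_sub_distrib] at hsum
  refine le_trans (sum_le_sum fun M hM => ?_) hsum
  have hg0 : 0 ≤ g M := sum_nonneg fun i _ => mul_nonneg (hz0 i) (entry_nonneg ..)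
  have hT0 : 0 ≤ (∑ i, z i) * din j₀ := mul_nonneg hz_sum0 (Nat.cast_nonneg _)
  have hT : (∑ i, z i) * din j₀ ≤ D * d :=
    mul_le_mul hD (hin j₀) (Nat.cast_nonneg _) (hz_sum0.trans hD)
  have hng : 0 ≤ n * g M := mul_nonneg (Nat.cast_nonneg _) hg0
  have h7 : 8 * (θ * δ) * (n * g M + (∑ i, z i) * din j₀) ≤ n * g M + (∑ i, z i) * din j₀ :=
    mul_le_of_le_one_left (by positivity) hδ
  have h8 : n * g M - 3 * D * d ≤ 2 * (n * g M) - 2 * ((∑ i, z i) * din j₀) -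
      4 * (θ * δ) * (2 * (n * g M) + 2 * ((∑ i, z i) * din j₀)) := by
    nlinarith
  calc (n * g M - 3 * D * d) * Real.exp (θ * g M)
      ≤ (2 * (n * g M) - 2 * ((∑ i, z i) * din j₀) -
      4 * (θ * δ) * (2 * (n * g M) + 2 * ((∑ i, z i) * din j₀))) * Real.exp (θ * g M) :=
        mul_le_mul_of_nonneg_right h8 (Real.exp_pos _).le
    _ = _ := by ring

end Statistics

/-! ### Exponential moments of column sums over a set of rows -/

section ColumnDeviation

variable {n : ℕ} {din dout : Fin n → ℕ}

/-- The deviation of the number of ones of the `j`-th column in the rows of `I` from its typical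
value `|I| dⁱⁿ_j / n`. -/
noncomputable def colDev (din : Fin n → ℕ) (I : Finset (Fin n)) (M : Matrix (Fin n) (Fin n) ℕ)
    (j : Fin n) : ℝ :=
  ∑ i ∈ I, (M i j : ℝ) - (#I : ℝ) / n * din j

/-- A matrix is typical if any two of its rows differ in at least `d / 2` places and if all its
columns, weighted by the deficits of the row sums, have sum at most `B`. -/
def IsTypical (d B : ℝ) (dout : Fin n → ℕ) (M : Matrix (Fin n) (Fin n) ℕ) : Prop :=
  (∀ i k, i ≠ k → d / 2 ≤ rowSymm M i k) ∧ ∀ j, deficitSum d dout M j ≤ B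

theorem abs_colDev_le {d : ℝ} (hin : ∀ j, (din j : ℝ) ≤ d) (I : Finset (Fin n))
    {M : Matrix (Fin n) (Fin n) ℕ} (hM : M ∈ adjFinset din dout) (j : Fin n) :
    |colDev din I M j| ≤ d := by
  have h0 : 0 ≤ ∑ i ∈ I, (M i j : ℝ) := sum_nonneg fun i _ => entry_nonneg ..
  have h1 : ∑ i ∈ I, (M i j : ℝ) ≤ din j := by
    rw [← sum_col hM j]
    exact sum_le_sum_of_subset_of_nonneg (subset_univ _) fun i _ _ => entry_nonneg ..
  have h2 : (#I : ℝ) / n ≤ 1 :=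
    div_le_one_of_le₀ (by exact_mod_cast (card_le_univ I).trans (by simp)) (Nat.cast_nonneg _)
  have h3 : (#I : ℝ) / n * din j ≤ din j :=
    mul_le_of_le_one_left (Nat.cast_nonneg _) h2
  have h4 : 0 ≤ (#I : ℝ) / n * din j := by positivity
  have := hin j
  rw [colDev, abs_le]
  constructor <;> linarith

/-- The error of the drift of a column sum for a pair of rows. -/
noncomputable def driftError (dout : Fin n → ℕ) (J : Finset (Fin n)) (M : Matrix (Fin n) (Fin n) ℕ)
    (i k : Fin n) : ℝ :=
  ((dout i : ℝ) - dout k) / rowSymm M i k *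
    ∑ j ∈ J, (rowDiff M i k j + rowDiff M k i j)

theorem sum_rowDiff_add_le (M : Matrix (Fin n) (Fin n) ℕ) (J : Finset (Fin n)) (i k : Fin n) :
    ∑ j ∈ J, (rowDiff M i k j + rowDiff M k i j) ≤
      ∑ j ∈ J, (M i j : ℝ) + ∑ j ∈ J, (M k j : ℝ) := by
  rw [← sum_add_distrib]
  exact sum_le_sum fun j _ => rowDiff_add_le M i k j

theorem abs_driftError_le (J : Finset (Fin n)) {M : Matrix (Fin n) (Fin n) ℕ}
    (hM : M ∈ adjFinset din dout) (i k : Fin n) :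
    |driftError dout J M i k| ≤ ∑ j ∈ J, (M i j : ℝ) + ∑ j ∈ J, (M k j : ℝ) := by
  have h0 : 0 ≤ ∑ j ∈ J, (rowDiff M i k j + rowDiff M k i j) :=
    sum_nonneg fun j _ => rowDiff_add_nonneg hM ..
  rw [driftError, abs_mul, abs_of_nonneg h0]
  exact (mul_le_of_le_one_left h0 (abs_div_rowSymm_le hM i k)).trans (sum_rowDiff_add_le M J i k)

theorem sum_sum_row (J : Finset (Fin n)) {M : Matrix (Fin n) (Fin n) ℕ}
    (hM : M ∈ adjFinset din dout) : ∑ i, ∑ j ∈ J, (M i j : ℝ) = ∑ j ∈ J, (din j : ℝ) := by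
  rw [sum_comm]
  exact sum_congr rfl fun j _ => sum_col hM j

/-- Sums over pairs of rows with the first in `I` and the second outside `I` are at most the sum
over all pairs. -/
theorem sum_pairs_le (I : Finset (Fin n)) (F : Fin n → Fin n → ℝ) (hF : ∀ i k, 0 ≤ F i k) :
    ∑ i ∈ I, ∑ k ∈ Iᶜ, F i k ≤ ∑ i, ∑ k, F i k :=
  (sum_le_sum fun i _ => sum_le_sum_of_subset_of_nonneg (subset_univ _) fun k _ _ => hF i k).trans
    (sum_le_sum_of_subset_of_nonneg (subset_univ _) fun i _ _ => sum_nonneg fun k _ => hF i k)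

theorem sum_sum_add (u v : Fin n → ℝ) :
    ∑ i, ∑ k, (u i + u k) * (v i + v k) = 2 * (n * ∑ i, u i * v i) +
      2 * ((∑ i, u i) * ∑ i, v i) := by
  have : ∀ i k, (u i + u k) * (v i + v k) = u i * v i + u k * v k + u i * v k + u k * v i :=
    fun i k => by ring
  simp only [this, sum_add_distrib, sum_const, card_univ, Fintype.card_fin, nsmul_eq_mul,
    ← mul_sum, ← sum_mul]
  ring

theorem sum_abs_driftError_le {d : ℝ} (hin : ∀ j, (din j : ℝ) ≤ d) (I J : Finset (Fin n))
    {M : Matrix (Fin n) (Fin n) ℕ} (hM : M ∈ adjFinset din dout) :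
    ∑ i ∈ I, ∑ k ∈ Iᶜ, |driftError dout J M i k| ≤ n * (2 * (#J * d)) := by
  refine (sum_pairs_le I _ fun i k => abs_nonneg _).trans ?_
  refine (sum_le_sum fun i _ => sum_le_sum fun k _ => abs_driftError_le J hM i k).trans ?_
  simp only [sum_add_distrib, sum_const, card_univ, Fintype.card_fin, nsmul_eq_mul, ← mul_sum,
    sum_sum_row J hM]
  have : ∑ j ∈ J, (din j : ℝ) ≤ #J * d := by
    rw [← nsmul_eq_mul]; exact sum_le_card_nsmul _ _ _ fun j _ => hin j
  nlinarith [(Nat.cast_nonneg n : (0 : ℝ) ≤ n)]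

theorem sum_abs_driftError_le_of_isTypical {d B A : ℝ} (hd : 0 < d)
    (hin : ∀ j, (din j : ℝ) ≤ d) (hout : ∀ i, (dout i : ℝ) ≤ d)
    (hA : ∑ i, (d - dout i) ≤ n * A) (I J : Finset (Fin n))
    {M : Matrix (Fin n) (Fin n) ℕ} (hM : M ∈ adjFinset din dout) (hG : IsTypical d B dout M) :
    ∑ i ∈ I, ∑ k ∈ Iᶜ, |driftError dout J M i k| ≤ n * (#J * (4 * B / d + 4 * A)) := by
  set z : Fin n → ℝ := fun i => d - dout i with hz
  have hz0 : ∀ i, 0 ≤ z i := fun i => sub_nonneg.2 (hout i)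
  set r : Fin n → ℝ := fun i => ∑ j ∈ J, (M i j : ℝ) with hr
  have hr0 : ∀ i, 0 ≤ r i := fun i => sum_nonneg fun j _ => entry_nonneg ..
  have hpt : ∀ i ∈ I, ∀ k ∈ Iᶜ,
      |driftError dout J M i k| ≤ 2 / d * ((z i + z k) * (r i + r k)) := by
    intro i hi k hk
    have hik : i ≠ k := by rintro rfl; exact (mem_compl.1 hk) hi
    have hS := hG.1 i k hik
    have h0 : 0 ≤ ∑ j ∈ J, (rowDiff M i k j + rowDiff M k i j) :=
      sum_nonneg fun j _ => rowDiff_add_nonneg hM ..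
    have hab : |(dout i : ℝ) - dout k| ≤ z i + z k := by
      rw [abs_le]
      have h1 := hz0 i
      have h2 := hz0 k
      simp only [hz] at h1 h2 ⊢
      constructor <;> linarith
    have hquot : |((dout i : ℝ) - dout k) / rowSymm M i k| ≤ 2 / d * (z i + z k) := by
      rw [abs_div, abs_of_nonneg (rowSymm_nonneg hM i k)]
      calc _ ≤ (z i + z k) / (d / 2) := by
            apply div_le_div₀ _ hab _ hS
            · exact add_nonneg (hz0 i) (hz0 k)
            · positivity
        _ = _ := by field_simp
    rw [driftError, abs_mul, abs_of_nonneg h0]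
    calc _ ≤ 2 / d * (z i + z k) * (r i + r k) :=
          mul_le_mul hquot (sum_rowDiff_add_le M J i k) h0
            (mul_nonneg (by positivity) (add_nonneg (hz0 i) (hz0 k)))
      _ = _ := by ring
  refine (sum_le_sum fun i hi => sum_le_sum fun k hk => hpt i hi k hk).trans ?_
  refine (sum_pairs_le I _ fun i k => ?_).trans ?_
  · exact mul_nonneg (by positivity)
      (mul_nonneg (add_nonneg (hz0 i) (hz0 k)) (add_nonneg (hr0 i) (hr0 k)))
  simp only [← mul_sum]
  rw [sum_sum_add]
  have h1 : ∑ i, z i * r i ≤ #J * B := by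
    simp only [hr, mul_sum]
    rw [sum_comm, ← nsmul_eq_mul]
    exact sum_le_card_nsmul _ _ _ fun j _ => hG.2 j
  have h2 : ∑ i, r i ≤ #J * d := by
    rw [hr, sum_sum_row J hM, ← nsmul_eq_mul]; exact sum_le_card_nsmul _ _ _ fun j _ => hin j
  have h3 : 0 ≤ ∑ i, r i := sum_nonneg fun i _ => hr0 i
  have h4 : 0 ≤ ∑ i, z i := sum_nonneg fun i _ => hz0 i
  have h5 : (∑ i, z i) * ∑ i, r i ≤ n * A * (#J * d) := mul_le_mul hA h2 h3 (h4.trans hA)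
  have h6 : (n : ℝ) * ∑ i, z i * r i ≤ n * (#J * B) :=
    mul_le_mul_of_nonneg_left h1 (Nat.cast_nonneg _)
  calc _ ≤ 2 / d * (2 * (n * (#J * B)) + 2 * (n * A * (#J * d))) := by gcongr
    _ = _ := by field_simp; ring

/-- The exponential moment of the deviation of the column sums over rows `I` and columns `J`.
The drift of this statistic under switchings of a row of `I` with a row outside `I` is `n` times
the statistic itself, up to `driftError`; the error is small for typical matrices, and the last
term accounts for the other ones. -/
theorem sum_exp_colDev_le_add_atypical {d B A θ σ : ℝ} (hd : 0 < d) (hn : 0 < n) (hθ : 0 ≤ θ)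
    (hσ : σ = 1 ∨ σ = -1) (hB : 0 ≤ B)
    (hin : ∀ j, (din j : ℝ) ≤ d) (hout : ∀ i, (dout i : ℝ) ≤ d)
    (hA : ∑ i, (d - dout i) ≤ n * A) (I J : Finset (Fin n)) [DecidablePred (IsTypical d B dout)] :
    ∑ M ∈ adjFinset din dout, Real.exp (θ * (σ * ∑ j ∈ J, colDev din I M j)) ≤
      #(adjFinset din dout) * Real.exp (θ * (#J * (4 * B / d + 4 * A + 8 * θ * d))) +
        θ * (#{M ∈ adjFinset din dout | ¬ IsTypical d B dout M} *
          (2 * (#J * d) * Real.exp (θ * (#J * d)))) := by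
  have hσ1 : |σ| = 1 := by rcases hσ with h | h <;> simp [h]
  have hσ2 : σ ^ 2 = 1 := by rcases hσ with h | h <;> simp [h]
  have hn' : (0 : ℝ) < n := by exact_mod_cast hn
  have hA0 : 0 ≤ A := by
    have : 0 ≤ ∑ i, (d - dout i) := sum_nonneg fun i _ => sub_nonneg.2 (hout i)
    exact nonneg_of_mul_nonneg_right (this.trans hA) hn'
  set f : Matrix (Fin n) (Fin n) ℕ → ℝ := fun M => σ * ∑ j ∈ J, colDev din I M j with hf
  have hf_lin : ∀ M, f M = ∑ q, ∑ p, (if p ∈ I then if q ∈ J then σ else 0 else 0) * (M p q : ℝ) -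
      σ * ∑ j ∈ J, (#I : ℝ) / n * din j := by
    intro M
    have h1 : ∑ q, ∑ p, (if p ∈ I then if q ∈ J then σ else 0 else 0) * (M p q : ℝ) =
        ∑ p ∈ I, ∑ q ∈ J, σ * (M p q : ℝ) := by
      rw [sum_comm]
      simp only [ite_mul, zero_mul, sum_ite_irrel, sum_const_zero, sum_ite_mem, univ_inter]
    rw [h1, sum_comm]
    simp only [hf, colDev, sum_sub_distrib, mul_sub, mul_sum]
  have key : ∀ i ∈ I, ∀ k ∈ Iᶜ,
      ∑ M ∈ adjFinset din dout, Real.exp (θ * f M) *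
        (σ * (∑ j ∈ J, (M i j : ℝ) - ∑ j ∈ J, (M k j : ℝ)) - |driftError dout J M i k|) ≤
      4 * θ * ∑ M ∈ adjFinset din dout, Real.exp (θ * f M) *
        (∑ j ∈ J, (M i j : ℝ) + ∑ j ∈ J, (M k j : ℝ)) := by
    intro i hi k hk
    have hk' : k ∉ I := mem_compl.1 hk
    have hdr := sum_exp_drift_le hθ f (fun _ q => if q ∈ J then σ else 0) i k
      (din := din) (dout := dout) (by
        intro M _ j l h1 h2 h3 h4
        rw [hf_lin, hf_lin, sub_sub_sub_cancel_right, linear_sub_switch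
          (fun p q => if p ∈ I then if q ∈ J then σ else 0 else 0) h1 h2 h3 h4]
        simp [hi, hk'])
    refine le_trans (sum_le_sum fun M hM => ?_) (hdr.trans ?_)
    · refine mul_le_mul_of_nonneg_left ?_ (Real.exp_pos _).le
      simp only [ite_mul, zero_mul, sum_ite_mem, univ_inter, ← mul_sum, sum_sub_distrib]
      refine sub_le_sub_left ?_ _
      have : ((dout i : ℝ) - dout k) / rowSymm M i k *
          (σ * ∑ j ∈ J, (rowDiff M i k j + rowDiff M k i j)) = σ * driftError dout J M i k := by
        rw [driftError]; ring
      rw [this]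
      refine (le_abs_self _).trans ?_
      rw [abs_mul, hσ1, one_mul]
    · refine mul_le_mul_of_nonneg_left (sum_le_sum fun M hM => ?_) (by positivity)
      refine mul_le_mul_of_nonneg_left ?_ (Real.exp_pos _).le
      simp only [ite_pow, hσ2, ite_mul, zero_mul, one_mul, sum_ite_mem, univ_inter, ne_eq,
        OfNat.ofNat_ne_zero, not_false_eq_true, zero_pow]
      exact sum_rowDiff_add_le M J i k
  have hsum := sum_le_sum fun i (hi : i ∈ I) => sum_le_sum fun k (hk : k ∈ Iᶜ) => key i hi k hk
  have hswap : ∀ H : Fin n → Fin n → Matrix (Fin n) (Fin n) ℕ → ℝ,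
      ∑ i ∈ I, ∑ k ∈ Iᶜ, ∑ M ∈ adjFinset din dout, Real.exp (θ * f M) * H i k M =
      ∑ M ∈ adjFinset din dout, Real.exp (θ * f M) * ∑ i ∈ I, ∑ k ∈ Iᶜ, H i k M := by
    intro H
    simp only [mul_sum]
    rw [sum_comm (s := adjFinset din dout)]
    exact sum_congr rfl fun i _ => sum_comm
  simp only [← mul_sum] at hsum
  rw [hswap, hswap] at hsum
  have hJd : ∑ j ∈ J, (din j : ℝ) ≤ #J * d := by
    rw [← nsmul_eq_mul]; exact sum_le_card_nsmul _ _ _ fun j _ => hin j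
  -- the linear part of the drift reproduces the statistic
  have e1 : ∀ M ∈ adjFinset din dout,
      ∑ i ∈ I, ∑ k ∈ Iᶜ, (σ * (∑ j ∈ J, (M i j : ℝ) - ∑ j ∈ J, (M k j : ℝ)) -
        |driftError dout J M i k|) =
      n * f M - ∑ i ∈ I, ∑ k ∈ Iᶜ, |driftError dout J M i k| := by
    intro M hM
    simp only [sum_sub_distrib]
    congr 1
    simp only [← mul_sum, sum_sub_distrib, sum_const, nsmul_eq_mul]
    have hc : (#Iᶜ : ℝ) = n - #I := by
      rw [card_compl, Fintype.card_fin, Nat.cast_sub (by simpa using card_le_univ I)]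
    have ht := sum_add_sum_compl I (fun i => ∑ j ∈ J, (M i j : ℝ))
    rw [sum_sum_row J hM] at ht
    have ht' : ∑ i ∈ Iᶜ, ∑ j ∈ J, (M i j : ℝ) =
        ∑ j ∈ J, (din j : ℝ) - ∑ i ∈ I, ∑ j ∈ J, (M i j : ℝ) := by linarith
    rw [hc, ht']
    simp only [hf, colDev, sum_sub_distrib, ← mul_sum]
    rw [sum_comm (s := J)]
    field_simp
    ring
  have e2 : ∀ M ∈ adjFinset din dout,
      ∑ i ∈ I, ∑ k ∈ Iᶜ, (∑ j ∈ J, (M i j : ℝ) + ∑ j ∈ J, (M k j : ℝ)) ≤ n * (2 * (#J * d)) := by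
    intro M hM
    refine (sum_pairs_le I _ fun i k => add_nonneg (sum_nonneg fun j _ => entry_nonneg ..)
      (sum_nonneg fun j _ => entry_nonneg ..)).trans ?_
    simp only [sum_add_distrib, sum_const, card_univ, Fintype.card_fin, nsmul_eq_mul, ← mul_sum,
      sum_sum_row J hM]
    nlinarith
  have f1 := sum_congr rfl fun M hM => congrArg (Real.exp (θ * f M) * ·) (e1 M hM)
  rw [f1] at hsum
  set μ : ℝ := #J * (4 * B / d + 4 * A + 8 * θ * d) with hμ
  have hpt : ∀ M ∈ adjFinset din dout,
      (f M - μ) * Real.exp (θ * f M) ≤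
        1 / n * (Real.exp (θ * f M) *
            (n * f M - ∑ i ∈ I, ∑ k ∈ Iᶜ, |driftError dout J M i k|) -
          4 * θ * (Real.exp (θ * f M) *
            ∑ i ∈ I, ∑ k ∈ Iᶜ, (∑ j ∈ J, (M i j : ℝ) + ∑ j ∈ J, (M k j : ℝ)))) +
        if ¬ IsTypical d B dout M then 2 * (#J * d) * Real.exp (θ * (#J * d)) else 0 := by
    intro M hM
    have h2 := e2 M hM
    have hE := Real.exp_pos (θ * f M)
    set T := ∑ i ∈ I, ∑ k ∈ Iᶜ, (∑ j ∈ J, (M i j : ℝ) + ∑ j ∈ J, (M k j : ℝ))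
    set D := ∑ i ∈ I, ∑ k ∈ Iᶜ, |driftError dout J M i k| with hD
    have hT : T / n ≤ 2 * (#J * d) := by rw [div_le_iff₀ hn']; linarith
    have hrw : 1 / n * (Real.exp (θ * f M) * (n * f M - D) -
          4 * θ * (Real.exp (θ * f M) * T)) =
        (f M - D / n - 4 * θ * (T / n)) * Real.exp (θ * f M) := by
      field_simp
    rw [hrw]
    have hθT : 4 * θ * (T / n) ≤ 4 * θ * (2 * (#J * d)) :=
      mul_le_mul_of_nonneg_left hT (by positivity)
    by_cases hG : IsTypical d B dout M
    · have h1 := sum_abs_driftError_le_of_isTypical hd hin hout hA I J hM hG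
      rw [← hD] at h1
      have hDn : D / n ≤ #J * (4 * B / d + 4 * A) := by rw [div_le_iff₀ hn']; linarith
      simp only [hG, not_true_eq_false, if_false, add_zero]
      refine mul_le_mul_of_nonneg_right ?_ hE.le
      rw [hμ]
      linarith
    · have h1 := sum_abs_driftError_le hin I J hM
      rw [← hD] at h1
      have hDn : D / n ≤ 2 * (#J * d) := by rw [div_le_iff₀ hn']; linarith
      simp only [hG, not_false_eq_true, if_true]
      have hfle : f M ≤ #J * d := by
        refine (le_abs_self _).trans ?_
        rw [hf, abs_mul, hσ1, one_mul, ← nsmul_eq_mul]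
        exact (abs_sum_le_sum_abs _ _).trans
          (sum_le_card_nsmul _ _ _ fun j _ => abs_colDev_le hin I hM j)
      have hexp : Real.exp (θ * f M) ≤ Real.exp (θ * (#J * d)) := by gcongr
      have h3 : (f M - μ) * Real.exp (θ * f M) ≤ (f M - D / n - 4 * θ * (T / n) +
          2 * (#J * d)) * Real.exp (θ * f M) := by
        refine mul_le_mul_of_nonneg_right ?_ hE.le
        have : 0 ≤ (#J : ℝ) * (4 * B / d + 4 * A) := by positivity
        rw [hμ]
        linarith
      have h4 : 2 * (#J * d) * Real.exp (θ * f M) ≤ 2 * (#J * d) * Real.exp (θ * (#J * d)) := by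
        gcongr
      linarith
  refine sum_exp_le_of_tilted_mean _ f hθ ((sum_le_sum hpt).trans ?_)
  rw [sum_add_distrib, ← mul_sum, sum_sub_distrib, ← mul_sum]
  have h7 : ∑ M ∈ adjFinset din dout, (if ¬ IsTypical d B dout M then
      2 * (#J * d) * Real.exp (θ * (#J * d)) else 0) =
      #{M ∈ adjFinset din dout | ¬ IsTypical d B dout M} *
          (2 * (#J * d) * Real.exp (θ * (#J * d))) := by
    rw [← sum_filter, sum_const, nsmul_eq_mul]
  rw [h7]
  have : 1 / (n : ℝ) * (∑ M ∈ adjFinset din dout, Real.exp (θ * f M) *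
            (n * f M - ∑ i ∈ I, ∑ k ∈ Iᶜ, |driftError dout J M i k|) -
          4 * θ * ∑ M ∈ adjFinset din dout, Real.exp (θ * f M) *
            ∑ i ∈ I, ∑ k ∈ Iᶜ, (∑ j ∈ J, (M i j : ℝ) + ∑ j ∈ J, (M k j : ℝ))) ≤ 0 :=
    mul_nonpos_of_nonneg_of_nonpos (by positivity) (sub_nonpos.2 hsum)
  linarith

end ColumnDeviation

/-! ### Products over tuples of distinct indices -/

section Tuples

open scoped Classical in
/-- If the entries of `z` are at most `b`, excluding repeated indices from the expansion of
`(∑ j, z j) ^ p` costs at most `p * b` in each factor. -/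
theorem pow_le_sum_injective {α : Type*} [Fintype α] {z : α → ℝ} {b c : ℝ}
    (hz : ∀ j, 0 ≤ z j) (hb : ∀ j, z j ≤ b) (hb0 : 0 ≤ b) (hc : 0 ≤ c) (p : ℕ)
    (h : c + p * b ≤ ∑ j, z j) :
    c ^ p ≤ ∑ f : Fin p → α, if Function.Injective f then ∏ i, z (f i) else 0 := by
  suffices H : ∀ q : ℕ, q ≤ p →
      c ^ q ≤ ∑ f : Fin q → α, if Function.Injective f then ∏ i, z (f i) else 0 from H p le_rfl
  intro q
  induction q with
  | zero => intro _; simp [Function.injective_of_subsingleton]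
  | succ q ih =>
    intro hq
    have hrest : ∀ f : Fin q → α, c ≤ ∑ x ∈ (univ.image f)ᶜ, z x := by
      intro f
      have h1 : ∑ x ∈ univ.image f, z x ≤ q * b := by
        have h2 : (#(univ.image f) : ℝ) ≤ q := by
          exact_mod_cast card_image_le.trans (by simp)
        calc _ ≤ #(univ.image f) • b := sum_le_card_nsmul _ _ _ fun x _ => hb x
          _ = #(univ.image f) * b := nsmul_eq_mul _ _
          _ ≤ q * b := mul_le_mul_of_nonneg_right h2 hb0
      have h3 := sum_add_sum_compl (univ.image f) z
      have h4 : (q : ℝ) * b ≤ p * b :=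
        mul_le_mul_of_nonneg_right (by exact_mod_cast (Nat.le_succ q).trans hq)
          hb0
      linarith
    rw [← (Fin.consEquiv (fun _ : Fin (q + 1) => α)).sum_comp, Fintype.sum_prod_type,
      sum_comm, pow_succ]
    refine (mul_le_mul_of_nonneg_right (ih ((Nat.le_succ q).trans hq)) hc).trans ?_
    rw [sum_mul]
    refine sum_le_sum fun f _ => ?_
    have hinj : ∀ x, Function.Injective (Fin.consEquiv (fun _ : Fin (q + 1) => α) (x, f)) ↔
        x ∉ Set.range f ∧ Function.Injective f := fun x => Fin.cons_injective_iff
    simp only [hinj, Fin.consEquiv_apply, Fin.prod_univ_succ, Fin.cons_zero, Fin.cons_succ]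
    by_cases hf : Function.Injective f
    · simp only [hf, if_true, and_true]
      rw [← sum_filter, ← sum_mul, mul_comm]
      refine mul_le_mul_of_nonneg_right ((hrest f).trans (le_of_eq ?_))
        (prod_nonneg fun i _ => hz _)
      refine sum_congr ?_ fun _ _ => rfl
      ext x
      simp [Set.mem_range]
    · simp [hf]

/-- A moment bound: if the joint exponential moments of `p` distinct coordinates are at most `B`,
then few points have all `exp (y x j)` at most `b` but a large sum of these numbers. -/
theorem card_large_sum_le {Ω α : Type*} [Fintype α] [DecidableEq α] (s : Finset Ω) (y : Ω → α → ℝ)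
    {b c B : ℝ} (p : ℕ) (hb0 : 0 ≤ b) (hc : 0 < c)
    (hB : ∀ J : Finset α, #J = p → ∑ x ∈ s, Real.exp (∑ j ∈ J, y x j) ≤ B) (hB0 : 0 ≤ B)
    [DecidablePred fun x => (∀ j, Real.exp (y x j) ≤ b) ∧ c + p * b ≤ ∑ j, Real.exp (y x j)] :
    (#{x ∈ s | (∀ j, Real.exp (y x j) ≤ b) ∧ c + p * b ≤ ∑ j, Real.exp (y x j)} : ℝ) ≤
      (Fintype.card α / c) ^ p * B := by
  classical
  set F : Ω → ℝ := fun x => ∑ f : Fin p → α,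
    if Function.Injective f then ∏ i, Real.exp (y x (f i)) else 0 with hF
  have hF0 : ∀ x, 0 ≤ F x := fun x => sum_nonneg fun f _ => by
    split_ifs
    · exact prod_nonneg fun i _ => (Real.exp_pos _).le
    · exact le_rfl
  have h1 : ∑ x ∈ s, F x ≤ (Fintype.card α : ℝ) ^ p * B := by
    rw [hF, sum_comm]
    have h2 : ∀ f : Fin p → α, ∑ x ∈ s,
        (if Function.Injective f then ∏ i, Real.exp (y x (f i)) else 0) ≤ B := by
      intro f
      by_cases hf : Function.Injective f
      · simp only [hf, if_true]
        refine le_trans (le_of_eq (sum_congr rfl fun x _ => ?_)) (hB (univ.image f) ?_)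
        · rw [sum_image fun a _ b _ h => hf h, Real.exp_sum]
        · rw [card_image_of_injective _ hf, card_univ, Fintype.card_fin]
      · simpa [hf] using hB0
    refine (sum_le_card_nsmul _ _ _ fun f _ => h2 f).trans (le_of_eq ?_)
    rw [nsmul_eq_mul, card_univ, Fintype.card_fun, Fintype.card_fin, Nat.cast_pow]
  rw [div_pow, div_mul_eq_mul_div, le_div_iff₀ (pow_pos hc p)]
  refine le_trans ?_ h1
  rw [← nsmul_eq_mul, ← sum_const]
  refine (sum_le_sum fun x hx => ?_).trans
    (sum_le_sum_of_subset_of_nonneg (filter_subset _ s) fun x _ _ => hF0 x)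
  obtain ⟨-, hx1, hx2⟩ := mem_filter.1 hx
  refine (pow_le_sum_injective (z := fun j => Real.exp (y x j)) (fun j => (Real.exp_pos _).le)
    hx1 hb0 hc.le p hx2).trans (le_of_eq (sum_congr rfl fun f _ => ?_))
  congr

end Tuples

/-! ### The Orlicz norm -/

section Orlicz

variable {n : ℕ}

theorem psiNorm_le {x : Fin n → ℝ} {s : ℝ} (hn : 0 < n) (hs : 0 < s)
    (h : ∑ i, Real.exp (|x i| / s) ≤ Real.exp 1 * n) : psiNorm x ≤ s := by
  have hn' : (0 : ℝ) < n := by exact_mod_cast hn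
  refine csInf_le ⟨0, fun t ht => ht.1.le⟩ ⟨hs, ?_⟩
  rw [one_div, ← div_eq_inv_mul]
  exact div_le_one_of_le₀ h (by positivity)

theorem sum_exp_le_of_psiNorm_lt {x : Fin n → ℝ} {s : ℝ} (hn : 0 < n) (h : psiNorm x < s) :
    ∑ i, Real.exp (|x i| / s) ≤ Real.exp 1 * n := by
  have hn' : (0 : ℝ) < n := by exact_mod_cast hn
  have hne : {s : ℝ | 0 < s ∧ 1 / (Real.exp 1 * n) * ∑ i, Real.exp (|x i| / s) ≤ 1}.Nonempty := by
    have h0 : 0 ≤ ∑ i, |x i| := sum_nonneg fun i _ => abs_nonneg _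
    refine ⟨1 + ∑ i, |x i|, by linarith, ?_⟩
    rw [one_div, ← div_eq_inv_mul]
    refine div_le_one_of_le₀ ?_ (by positivity)
    have h1 : ∀ i ∈ (univ : Finset (Fin n)),
        Real.exp (|x i| / (1 + ∑ i, |x i|)) ≤ Real.exp 1 := by
      intro i hi
      gcongr
      refine div_le_one_of_le₀ ?_ (by linarith)
      have := single_le_sum (fun i _ => abs_nonneg (x i)) hi
      linarith
    refine (sum_le_card_nsmul _ _ _ h1).trans (le_of_eq ?_)
    rw [nsmul_eq_mul, card_univ, Fintype.card_fin, mul_comm]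
  obtain ⟨t, ⟨ht0, ht⟩, hts⟩ := exists_lt_of_csInf_lt hne h
  rw [one_div, ← div_eq_inv_mul, div_le_one (by positivity)] at ht
  refine le_trans (sum_le_sum fun i _ => ?_) ht
  gcongr

/-- Jensen's inequality in the form used for the exponential Orlicz norm. -/
theorem sum_le_of_sum_exp_le {x : Fin n → ℝ} {s : ℝ} (hs : 0 < s)
    (h : ∑ i, Real.exp (x i / s) ≤ Real.exp 1 * n) : ∑ i, x i ≤ n * (2 * s) := by
  have h1 : ∑ i : Fin n, (x i / s + 1) ≤ Real.exp 1 * n :=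
    (sum_le_sum fun i _ => Real.add_one_le_exp _).trans h
  rw [sum_add_distrib, ← sum_div] at h1
  simp only [sum_const, card_univ, Fintype.card_fin, nsmul_eq_mul, mul_one] at h1
  have h2 : (∑ i, x i) / s ≤ n * 2 := by
    nlinarith [Real.exp_one_lt_d9, (Nat.cast_nonneg n : (0 : ℝ) ≤ n)]
  rw [div_le_iff₀ hs] at h2
  linarith

theorem le_of_sum_exp_le {x : Fin n → ℝ} {s : ℝ} (hs : 0 < s)
    (h : ∑ i, Real.exp (x i / s) ≤ Real.exp 1 * n) (i : Fin n) :
    x i ≤ s * (1 + Real.log n) := by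
  have hn : (0 : ℝ) < n := by exact_mod_cast i.pos
  have h1 : Real.exp (x i / s) ≤ Real.exp 1 * n :=
    (single_le_sum (f := fun i => Real.exp (x i / s)) (fun i _ => (Real.exp_pos _).le)
      (mem_univ i)).trans h
  have h2 := Real.log_le_log (Real.exp_pos _) h1
  rw [Real.log_exp, Real.log_mul (Real.exp_pos 1).ne' hn.ne', Real.log_exp, div_le_iff₀ hs] at h2
  linarith

theorem exp_quarter_le (x : ℝ) :
    Real.exp (x / 4) ≤ Real.exp (1 / 4) * (3 / 4 + Real.exp (x - 1) / 4) := by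
  have h1 : Real.exp (x / 4) = Real.exp (1 / 4) * Real.exp ((x - 1) / 4) := by
    rw [← Real.exp_add]; ring_nf
  have h2 : Real.exp (x - 1) = Real.exp ((x - 1) / 4) ^ 4 := by
    rw [← Real.exp_nat_mul]; ring_nf
  rw [h1, h2]
  refine mul_le_mul_of_nonneg_left ?_ (Real.exp_pos _).le
  set t := Real.exp ((x - 1) / 4)
  nlinarith [sq_nonneg (t ^ 2 - 1), sq_nonneg (t - 1)]

theorem sum_exp_quarter_le {x : Fin n → ℝ} (h : ∑ i, Real.exp (x i) ≤ Real.exp 1 * n) :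
    ∑ i, Real.exp (x i / 4) ≤ Real.exp (1 / 4) * n := by
  refine (sum_le_sum fun i _ => exp_quarter_le (x i)).trans ?_
  rw [← mul_sum]
  refine mul_le_mul_of_nonneg_left ?_ (Real.exp_pos _).le
  simp only [sum_add_distrib, sum_const, card_univ, Fintype.card_fin, nsmul_eq_mul, ← sum_div,
    Real.exp_sub, div_div]
  have : (∑ i, Real.exp (x i)) / (Real.exp 1 * 4) ≤ n / 4 := by
    rw [div_le_div_iff₀ (by positivity) (by positivity)]
    linarith
  linarith

/-- Passing from a vector `u + v` to the vector of the summed distances of its coordinates. -/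
theorem psiNorm_le_of_sum_exp {u v w : Fin n → ℝ} {A : ℝ} (hA : 0 < A) (hn : 0 < n)
    (hu : ∑ i, Real.exp (u i / A) ≤ Real.exp 1 * n)
    (hv : ∑ i, Real.exp (v i / A) ≤ Real.exp 1 * n)
    (hw : ∀ j, |w j| ≤ ∑ l, (u j + v j + (u l + v l))) : psiNorm w ≤ 8 * A * n := by
  have hn' : (0 : ℝ) < n := by exact_mod_cast hn
  have hsu := sum_le_of_sum_exp_le hA hu
  have hsv := sum_le_of_sum_exp_le hA hv
  refine psiNorm_le hn (by positivity) ?_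
  have hpt : ∀ j, Real.exp (|w j| / (8 * A * n)) ≤
      Real.exp (1 / 2) * ((Real.exp (u j / A / 4) + Real.exp (v j / A / 4)) / 2) := by
    intro j
    have h1 : |w j| ≤ n * (u j + v j) + n * (4 * A) := by
      refine (hw j).trans ?_
      simp only [sum_add_distrib, sum_const, card_univ, Fintype.card_fin, nsmul_eq_mul]
      linarith
    have h2 : |w j| / (8 * A * n) ≤ 1 / 2 + (u j / A / 4 / 2 + v j / A / 4 / 2) := by
      rw [div_le_iff₀ (by positivity)]
      refine h1.trans (le_of_eq ?_)
      field_simp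
      ring
    refine (Real.exp_le_exp.2 h2).trans ?_
    rw [Real.exp_add (1 / 2)]
    refine mul_le_mul_of_nonneg_left ?_ (Real.exp_pos _).le
    have e : ∀ t : ℝ, Real.exp t = Real.exp (t / 2) ^ 2 := fun t => by
      rw [← Real.exp_nat_mul]; congr 1; push_cast; ring
    rw [Real.exp_add, e (u j / A / 4), e (v j / A / 4)]
    nlinarith [sq_nonneg (Real.exp (u j / A / 4 / 2) - Real.exp (v j / A / 4 / 2))]
  refine (sum_le_sum fun j _ => hpt j).trans ?_
  rw [← mul_sum, ← sum_div, sum_add_distrib]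
  have h3 := sum_exp_quarter_le hu
  have h4 := sum_exp_quarter_le hv
  calc _ ≤ Real.exp (1 / 2) * ((Real.exp (1 / 4) * n + Real.exp (1 / 4) * n) / 2) := by gcongr
    _ = Real.exp (1 / 2 + 1 / 4) * n := by rw [Real.exp_add]; ring
    _ ≤ Real.exp 1 * n := by gcongr; norm_num

end Orlicz

/-! ### Typical matrices in the dense regime -/

section Regime

/-- The lower bound for `√d` in units of `(1 + log n) ^ 2`. It is `2000 (5 K + 3)` with
`K = 8 (m + 5)`, where `K (1 + log n)` bounds the number of columns in the moment estimates and
`exp (-d / (2000 (1 + log n)))` is the order of the probability of a matrix that is not typical. -/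
def growthConst (m : ℕ) : ℝ := 80000 * m + 406000

/-- The deterministic assumptions on the degree sequences that the probabilistic estimates use,
for `n` beyond its threshold. They are symmetric in the two sequences. -/
structure DenseRegime (L : ℝ) (m n d : ℕ) (din dout : Fin n → ℕ) : Prop where
  one_le : 1 ≤ L
  le_n : 1000 ≤ n
  d_le : (d : ℝ) ≤ 501 / 1000 * n
  growth : growthConst m * (1 + Real.log n) ^ 2 ≤ √(d : ℝ)
  le_din : ∀ i, 999 / 1000 * (d : ℝ) ≤ din i
  din_le : ∀ i, (din i : ℝ) ≤ d
  le_dout : ∀ i, 999 / 1000 * (d : ℝ) ≤ dout i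
  dout_le : ∀ i, (dout i : ℝ) ≤ d
  exp_din : ∑ i, Real.exp (((d : ℝ) - din i) / (2 * L * √(d : ℝ))) ≤ Real.exp 1 * n
  exp_dout : ∑ i, Real.exp (((d : ℝ) - dout i) / (2 * L * √(d : ℝ))) ≤ Real.exp 1 * n

namespace DenseRegime

variable {L : ℝ} {m n d : ℕ} {din dout : Fin n → ℕ}

theorem swap (h : DenseRegime L m n d din dout) : DenseRegime L m n d dout din :=
  ⟨h.one_le, h.le_n, h.d_le, h.growth, h.le_dout, h.dout_le, h.le_din, h.din_le, h.exp_dout,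
    h.exp_din⟩

theorem n_real (h : DenseRegime L m n d din dout) : (1000 : ℝ) ≤ n := by exact_mod_cast h.le_n

theorem log_nonneg (h : DenseRegime L m n d din dout) : 0 ≤ Real.log n :=
  Real.log_nonneg (by linarith [h.n_real])

theorem growthConst_le : (406000 : ℝ) ≤ growthConst m := by
  unfold growthConst; have : (0:ℝ) ≤ m := Nat.cast_nonneg m; linarith

theorem sqrt_ge (h : DenseRegime L m n d din dout) :
    growthConst m * (1 + Real.log n) ≤ √(d : ℝ) := by
  refine le_trans ?_ h.growth
  have h1 := h.log_nonneg
  refine mul_le_mul_of_nonneg_left ?_ (by linarith [growthConst_le (m := m)])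
  nlinarith

theorem sqrt_large (h : DenseRegime L m n d din dout) : 406000 ≤ √(d : ℝ) := by
  refine le_trans ?_ h.sqrt_ge
  nlinarith [growthConst_le (m := m), h.log_nonneg]

theorem sqrt_pos (h : DenseRegime L m n d din dout) : 0 < √(d : ℝ) := by
  linarith [h.sqrt_large]

theorem sq_sqrt (_ : DenseRegime L m n d din dout) : √(d : ℝ) * √(d : ℝ) = d :=
  Real.mul_self_sqrt (Nat.cast_nonneg d)

theorem d_pos (h : DenseRegime L m n d din dout) : (0 : ℝ) < d := by
  rw [← h.sq_sqrt]; exact mul_pos h.sqrt_pos h.sqrt_pos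

theorem scale_pos (h : DenseRegime L m n d din dout) : 0 < 2 * L * √(d : ℝ) :=
  mul_pos (by linarith [h.one_le]) h.sqrt_pos

theorem sum_deficit_le (h : DenseRegime L m n d din dout) :
    ∑ i, ((d : ℝ) - dout i) ≤ n * (4 * L * √(d : ℝ)) := by
  have := sum_le_of_sum_exp_le h.scale_pos h.exp_dout
  linarith

theorem deficit_le (h : DenseRegime L m n d din dout) (i : Fin n) :
    (d : ℝ) - dout i ≤ 2 * L * √(d : ℝ) * (1 + Real.log n) :=
  le_of_sum_exp_le h.scale_pos h.exp_dout i

/-- Two given rows overlap in more than `0.6 d` places with exponentially small probability. -/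
theorem card_rowOverlap_le (h : DenseRegime L m n d din dout) {i r : Fin n} (hri : r ≠ i) :
    (#{M ∈ adjFinset din dout | 3 / 5 * (d : ℝ) ≤ rowOverlap M i r} : ℝ) ≤
      #(adjFinset din dout) * Real.exp (-(1 / 2000 * d)) := by
  have hd := h.d_pos
  have hn := h.n_real
  have hdiff : ∀ i k, |(dout i : ℝ) - dout k| ≤ 1 / 1000 * d := by
    intro i k
    have := h.le_dout i; have := h.le_dout k; have := h.dout_le i; have := h.dout_le k
    rw [abs_le]; constructor <;> linarith
  have h1 := sum_exp_rowOverlap_le (θ := 1 / 100) (by norm_num) (by positivity) h.din_le h.dout_le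
    hdiff hri
  -- `0.544 d` bounds `d² / n + 2 d / n + 0.001 d + 0.04 d`, as `d ≤ 0.501 n` and `2 / n ≤ 0.002`
  have h2 : ∑ M ∈ adjFinset din dout, (rowOverlap M i r - 544 / 1000 * d) *
      Real.exp (1 / 100 * rowOverlap M i r) ≤ 0 := by
    have h3 : (d : ℝ) ^ 2 + 2 * d + n * (1 / 1000 * d) + 4 * (1 / 100) * n * d ≤
        n * (544 / 1000 * d) := by
      have := h.d_le
      nlinarith
    have hn' : (0 : ℝ) < n := by linarith
    refine nonpos_of_mul_nonpos_right ?_ hn'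
    refine le_trans ?_ h1
    rw [mul_sum]
    refine sum_le_sum fun M _ => ?_
    rw [← mul_assoc]
    refine mul_le_mul_of_nonneg_right ?_ (Real.exp_pos _).le
    linarith
  have h4 := sum_exp_le_of_tilted_mean _ _ (by norm_num : (0 : ℝ) ≤ 1 / 100) h2
  rw [mul_zero, add_zero] at h4
  refine (card_filter_le_of_sum_exp_le _ _ (by norm_num) h4).trans ?_
  rw [mul_assoc, ← Real.exp_add]
  gcongr
  linarith

/-- The weighted sum of a given column exceeds twice its tilted mean `12 L √d d` with probability
exponentially small in `d / log n`. The exponential rate is limited by the largest deficit, which is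
of order `√d log n`. -/
theorem card_deficitSum_le (h : DenseRegime L m n d din dout) (j : Fin n) :
    (#{M ∈ adjFinset din dout | 24 * L * √(d : ℝ) * d ≤ deficitSum d dout M j} : ℝ) ≤
      #(adjFinset din dout) * Real.exp (-(3 / 4 * d / (1 + Real.log n))) := by
  have hd := h.d_pos
  have hn := h.n_real
  have hL := h.one_le
  have hs := h.sqrt_pos
  have hl : 0 < 1 + Real.log n := by linarith [h.log_nonneg]
  have hn' : (0 : ℝ) < n := by linarith
  set δ : ℝ := 2 * L * √(d : ℝ) * (1 + Real.log n) with hδ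
  have hδ0 : 0 < δ := mul_pos h.scale_pos hl
  have h1 := sum_exp_deficitSum_le (θ := 1 / (8 * δ)) (δ := δ) (by positivity)
    (le_of_eq (by field_simp)) h.dout_le h.din_le h.deficit_le h.sum_deficit_le j
  have h2 : ∑ M ∈ adjFinset din dout, (deficitSum d dout M j - 12 * L * √(d : ℝ) * d) *
      Real.exp (1 / (8 * δ) * deficitSum d dout M j) ≤ 0 := by
    refine nonpos_of_mul_nonpos_right ?_ hn'
    refine le_trans (le_of_eq ?_) h1
    rw [mul_sum]
    refine sum_congr rfl fun M _ => ?_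
    ring
  have h4 := sum_exp_le_of_tilted_mean _ _ (by positivity : (0 : ℝ) ≤ 1 / (8 * δ)) h2
  rw [mul_zero, add_zero] at h4
  refine (card_filter_le_of_sum_exp_le _ _ (by positivity) h4).trans ?_
  rw [mul_assoc, ← Real.exp_add]
  gcongr
  rw [hδ]
  apply le_of_eq
  field_simp
  ring

open scoped Classical in
theorem card_not_isTypical_le (h : DenseRegime L m n d din dout) :
    (#{M ∈ adjFinset din dout | ¬ IsTypical d (24 * L * √(d : ℝ) * d) dout M} : ℝ) ≤
      #(adjFinset din dout) *
        (2 * (n : ℝ) ^ 2 * Real.exp (-(1 / 2000 * d / (1 + Real.log n)))) := by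
  have hd := h.d_pos
  have hn := h.n_real
  have hl : 1 ≤ 1 + Real.log n := by linarith [h.log_nonneg]
  set N : ℝ := (#(adjFinset din dout) : ℝ)
  set E := Real.exp (-(1 / 2000 * d / (1 + Real.log n))) with hE
  have hN : 0 ≤ N := Nat.cast_nonneg _
  have hcover : ({M ∈ adjFinset din dout | ¬ IsTypical d (24 * L * √(d : ℝ) * d) dout M}) ⊆
      ((univ : Finset (Fin n × Fin n)).biUnion fun q =>
        {M ∈ adjFinset din dout | q.2 ≠ q.1 ∧ 3 / 5 * (d : ℝ) ≤ rowOverlap M q.1 q.2}) ∪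
      ((univ : Finset (Fin n)).biUnion fun j =>
        {M ∈ adjFinset din dout | 24 * L * √(d : ℝ) * d ≤ deficitSum d dout M j}) := by
    intro M hM
    obtain ⟨hM, hnt⟩ := mem_filter.1 hM
    by_contra hcon
    simp only [mem_union, mem_biUnion, mem_univ, true_and, mem_filter, not_or, not_exists, not_and,
      hM, not_le, Prod.forall] at hcon
    refine hnt ⟨fun i k hik => ?_, fun j => (hcon.2 j).le⟩
    have h1 := hcon.1 i k hik.symm
    rw [rowSymm_eq hM]
    have := h.le_dout i; have := h.le_dout k
    linarith
  have h1 : ∀ q : Fin n × Fin n, (#{M ∈ adjFinset din dout | q.2 ≠ q.1 ∧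
      3 / 5 * (d : ℝ) ≤ rowOverlap M q.1 q.2} : ℝ) ≤ N * E := by
    intro q
    by_cases hq : q.2 = q.1
    · simp only [hq, ne_eq, not_true_eq_false, false_and, filter_false, card_empty, Nat.cast_zero]
      positivity
    · simp only [ne_eq, hq, not_false_eq_true, true_and]
      refine (h.card_rowOverlap_le hq).trans ?_
      refine mul_le_mul_of_nonneg_left (Real.exp_le_exp.2 (neg_le_neg ?_)) hN
      exact div_le_self (by positivity) hl
  have h2 : ∀ j, (#{M ∈ adjFinset din dout |
      24 * L * √(d : ℝ) * d ≤ deficitSum d dout M j} : ℝ) ≤ N * E := by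
    intro j
    refine (h.card_deficitSum_le j).trans ?_
    refine mul_le_mul_of_nonneg_left (Real.exp_le_exp.2 (neg_le_neg ?_)) hN
    gcongr <;> norm_num
  have hE0 : 0 < E := Real.exp_pos _
  calc _ ≤ ((#((univ : Finset (Fin n × Fin n)).biUnion fun q =>
        {M ∈ adjFinset din dout | q.2 ≠ q.1 ∧ 3 / 5 * (d : ℝ) ≤ rowOverlap M q.1 q.2}) : ℕ) : ℝ) +
      ((#((univ : Finset (Fin n)).biUnion fun j =>
        {M ∈ adjFinset din dout | 24 * L * √(d : ℝ) * d ≤ deficitSum d dout M j}) : ℕ) : ℝ) := by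
        exact_mod_cast (card_le_card hcover).trans (card_union_le _ _)
    _ ≤ ∑ _q : Fin n × Fin n, N * E + ∑ _j : Fin n, N * E := by
        refine add_le_add ?_ ?_
        · refine le_trans (Nat.cast_le.2 card_biUnion_le) ?_
          push_cast
          exact sum_le_sum fun q _ => h1 q
        · refine le_trans (Nat.cast_le.2 card_biUnion_le) ?_
          push_cast
          exact sum_le_sum fun j _ => h2 j
    _ = (n * n + n) * (N * E) := by
        simp only [sum_const, card_univ, Fintype.card_prod, Fintype.card_fin, nsmul_eq_mul,
          Nat.cast_mul]
        ring
    _ ≤ (2 * (n : ℝ) ^ 2) * (N * E) := by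
        refine mul_le_mul_of_nonneg_right ?_ (by positivity)
        nlinarith
    _ = _ := by ring

/-- The growth of `d` beats the loss from matrices that are not typical: the largest possible
exponential moment of `k` columns, times the probability of these matrices, is at most `1`. -/
theorem atypical_loss_le (h : DenseRegime L m n d din dout) {k : ℝ}
    (hk : k ≤ 8 * (m + 5) * (1 + Real.log n)) :
    2 * (n : ℝ) ^ 2 * Real.exp (-(1 / 2000 * d / (1 + Real.log n))) *
      (2 * Real.exp (k * √(d : ℝ)) * Real.exp (k * √(d : ℝ))) ≤ 1 := by
  have hn := h.n_real
  have hs := h.sqrt_pos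
  have hss := h.sq_sqrt
  have hl : 1 ≤ 1 + Real.log n := by linarith [h.log_nonneg]
  have hgr := h.growth
  have hx1 := h.sqrt_large
  set x := √(d : ℝ) with hx
  set l := 1 + Real.log n with hldef
  have hn2 : (n : ℝ) ^ 2 = Real.exp (2 * Real.log n) := by
    rw [mul_comm, Real.exp_mul, Real.exp_log (by linarith)]
    norm_num
  have h4e : (4 : ℝ) ≤ Real.exp 2 := by
    have := Real.add_one_le_exp (1 : ℝ)
    have h2 : Real.exp 2 = Real.exp 1 * Real.exp 1 := by rw [← Real.exp_add]; norm_num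
    rw [h2]; nlinarith
  have hq : (growthConst m / 2000) * l * x ≤ 1 / 2000 * d / l := by
    rw [le_div_iff₀ (by linarith), ← hss]
    nlinarith
  have hkx2 : k * x ≤ 8 * (m + 5) * l * x := mul_le_mul_of_nonneg_right hk hs.le
  have hlx : 406000 ≤ l * x := by nlinarith
  have hllx : l ≤ l * x := by nlinarith
  have hm0 : (0 : ℝ) ≤ m := Nat.cast_nonneg m
  have hfin : 2 + 2 * Real.log n + -(1 / 2000 * d / l) + k * x + k * x ≤ 0 := by
    have h8 : (growthConst m / 2000) * l * x = 40 * (m * (l * x)) + 203 * (l * x) := by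
      unfold growthConst; ring
    have h9 : 8 * ((m : ℝ) + 5) * l * x = 8 * (m * (l * x)) + 40 * (l * x) := by ring
    have h10 : 0 ≤ (m : ℝ) * (l * x) := by positivity
    linarith
  calc _ = 4 * Real.exp (2 * Real.log n) * Real.exp (-(1 / 2000 * d / l)) *
        Real.exp (k * x) * Real.exp (k * x) := by rw [hn2]; ring
    _ ≤ Real.exp 2 * Real.exp (2 * Real.log n) * Real.exp (-(1 / 2000 * d / l)) *
        Real.exp (k * x) * Real.exp (k * x) := by gcongr
    _ = Real.exp (2 + 2 * Real.log n + -(1 / 2000 * d / l) + k * x + k * x) := by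
        simp only [Real.exp_add]
    _ ≤ 1 := Real.exp_le_one_iff.2 hfin

/-- The exponential moment of the deviations of at most `8 (m + 5) (1 + log n)` columns. -/
theorem sum_exp_colDev_le (h : DenseRegime L m n d din dout) {lam σ : ℝ} (hlam : 0 ≤ lam)
    (hlamL : lam * (1200 * L) ≤ 1) (hσ : σ = 1 ∨ σ = -1) (I J : Finset (Fin n))
    (hJ : (#J : ℝ) ≤ 8 * (m + 5) * (1 + Real.log n)) :
    ∑ M ∈ adjFinset din dout,
        Real.exp (lam / √(d : ℝ) * (σ * ∑ j ∈ J, colDev din I M j)) ≤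
      #(adjFinset din dout) * (Real.exp (#J / 10) + 1) := by
  classical
  have hd := h.d_pos
  have hL := h.one_le
  have hs := h.sqrt_pos
  have hss := h.sq_sqrt
  set x := √(d : ℝ) with hx
  set l := 1 + Real.log n with hldef
  set N : ℝ := (#(adjFinset din dout) : ℝ)
  have hN : 0 ≤ N := Nat.cast_nonneg _
  have hk0 : (0 : ℝ) ≤ #J := Nat.cast_nonneg _
  have hlam1 : lam ≤ 1 / 1200 := by nlinarith
  have main := sum_exp_colDev_le_add_atypical (σ := σ) (θ := lam / x) (B := 24 * L * x * d)
    (A := 4 * L * x) hd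
    (by linarith [h.le_n] : 0 < n) (by positivity) hσ (by positivity) h.din_le h.dout_le
    h.sum_deficit_le I J
  refine main.trans ?_
  rw [mul_add N, mul_one]
  refine add_le_add ?_ ?_
  · refine mul_le_mul_of_nonneg_left (Real.exp_le_exp.2 ?_) hN
    -- the tilted mean is at most `#J * (112 L + 8 lam) √d`
    have h1 : lam / x * (#J * (4 * (24 * L * x * d) / d + 4 * (4 * L * x) + 8 * (lam / x) * d)) =
        #J * (112 * (lam * L) + 8 * lam ^ 2) := by
      rw [← hss]
      field_simp
      ring
    rw [h1]
    have h2 : 112 * (lam * L) + 8 * lam ^ 2 ≤ 1 / 10 := by nlinarith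
    calc (#J : ℝ) * (112 * (lam * L) + 8 * lam ^ 2) ≤ #J * (1 / 10) := by gcongr
      _ = _ := by ring
  · have h3 := h.card_not_isTypical_le
    set C : ℝ := (#{M ∈ adjFinset din dout | ¬ IsTypical d (24 * L * x * d) dout M} : ℝ)
    set k : ℝ := (#J : ℝ) with hk
    have h4 : lam / x * (C * (2 * (k * d) * Real.exp (lam / x * (k * d)))) =
        C * (2 * (lam * (k * x)) * Real.exp (lam * (k * x))) := by
      have : lam / x * (k * d) = lam * (k * x) := by rw [← hss]; field_simp
      rw [← this]; ring
    rw [h4]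
    have hkx : 0 ≤ k * x := by positivity
    have h5 : lam * (k * x) ≤ k * x := mul_le_of_le_one_left hkx (by linarith)
    have h6 : 2 * (lam * (k * x)) * Real.exp (lam * (k * x)) ≤
        2 * Real.exp (k * x) * Real.exp (k * x) := by
      have : k * x ≤ Real.exp (k * x) := by linarith [Real.add_one_le_exp (k * x)]
      gcongr
      linarith
    have h7 := h.atypical_loss_le hJ
    rw [← hx, ← hldef] at h7
    calc C * (2 * (lam * (k * x)) * Real.exp (lam * (k * x)))
        ≤ N * (2 * (n : ℝ) ^ 2 * Real.exp (-(1 / 2000 * d / l))) *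
          (2 * Real.exp (k * x) * Real.exp (k * x)) := by
          refine mul_le_mul h3 h6 (by positivity) (by positivity)
      _ = N * (2 * (n : ℝ) ^ 2 * Real.exp (-(1 / 2000 * d / l)) *
          (2 * Real.exp (k * x) * Real.exp (k * x))) := by ring
      _ ≤ N * 1 := mul_le_mul_of_nonneg_left h7 hN
      _ = N := mul_one N

end DenseRegime

end Regime

/-! ### All intervals simultaneously -/

theorem exp_one_div_four_le : Real.exp (1 / 4) ≤ 13 / 10 := by
  refine le_of_pow_le_pow_left₀ (n := 4) (by norm_num) (by norm_num) ?_
  rw [← Real.exp_nat_mul]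
  norm_num
  linarith [Real.exp_one_lt_d9]

namespace DenseRegime

variable {L : ℝ} {m n d : ℕ} {din dout : Fin n → ℕ}

/-- The tail of the deviation of a single column, at the finest scale that the exponential moment
allows. -/
theorem card_colDev_le (h : DenseRegime L m n d din dout) {σ : ℝ} (hσ : σ = 1 ∨ σ = -1)
    (I : Finset (Fin n)) (j : Fin n) :
    (#{M ∈ adjFinset din dout |
        (m + 6) * Real.log n ≤ 1 / (1200 * L) / √(d : ℝ) * (σ * colDev din I M j)} : ℝ) ≤
      #(adjFinset din dout) * (3 / (n : ℝ) ^ (m + 6)) := by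
  have hL := h.one_le
  have hn : (0 : ℝ) < n := by linarith [h.n_real]
  have hl := h.log_nonneg
  have h1 := h.sum_exp_colDev_le (lam := 1 / (1200 * L)) (by positivity)
    (le_of_eq (by field_simp)) hσ I {j} (by
      rw [card_singleton]
      have : (0 : ℝ) ≤ m * (1 + Real.log n) := by positivity
      push_cast
      nlinarith)
  simp only [sum_singleton, card_singleton] at h1
  have h2 := card_filter_le_of_sum_exp_le (adjFinset din dout)
    (fun M => 1 / (1200 * L) / √(d : ℝ) * (σ * colDev din I M j)) (θ := 1)
    (t := (m + 6) * Real.log n) zero_le_one (by simpa only [one_mul] using h1)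
  refine h2.trans ?_
  have h3 : Real.exp (-(1 * ((m + 6) * Real.log n))) = 1 / (n : ℝ) ^ (m + 6) := by
    have : 1 * (((m : ℝ) + 6) * Real.log n) = ((m + 6 : ℕ) : ℝ) * Real.log n := by
      push_cast; ring
    rw [this, Real.exp_neg, Real.exp_nat_mul, Real.exp_log hn, one_div]
  have h4 : Real.exp (((1 : ℕ) : ℝ) / 10) + 1 ≤ 3 := by
    have : Real.exp (((1 : ℕ) : ℝ) / 10) ≤ Real.exp (1 / 4) := by gcongr <;> norm_num
    linarith [exp_one_div_four_le]
  rw [h3, mul_assoc]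
  refine mul_le_mul_of_nonneg_left ?_ (Nat.cast_nonneg _)
  rw [mul_one_div]
  gcongr

/-- The number of distinct columns used in the moment bound. -/
noncomputable def momentSize (m n : ℕ) : ℕ := ⌈7 * ((m : ℝ) + 5) * (1 + Real.log n)⌉₊

theorem momentSize_le (h : DenseRegime L m n d din dout) :
    (momentSize m n : ℝ) ≤ 8 * (m + 5) * (1 + Real.log n) := by
  have hl := h.log_nonneg
  have h1 : (momentSize m n : ℝ) < _ :=
    Nat.ceil_lt_add_one (by positivity : 0 ≤ 7 * ((m : ℝ) + 5) * (1 + Real.log n))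
  have h2 : (0 : ℝ) ≤ m * (1 + Real.log n) := by positivity
  nlinarith

open scoped Classical in
/-- Apart from the columns with exceptionally large deviation, the one-sided exponential sums over
the columns are small with polynomially high probability. -/
theorem card_sum_exp_le (h : DenseRegime L m n d din dout) {σ lam : ℝ} (hσ : σ = 1 ∨ σ = -1)
    (hlam : 0 ≤ lam) (hlamL : lam * (1200 * L) ≤ 1) (I : Finset (Fin n)) :
    (#{M ∈ adjFinset din dout |
        (∀ j, Real.exp (lam / √(d : ℝ) * (σ * colDev din I M j)) ≤ √(n : ℝ)) ∧
        27 / 20 * n ≤ ∑ j, Real.exp (lam / √(d : ℝ) * (σ * colDev din I M j))} : ℝ) ≤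
      #(adjFinset din dout) * (2 / (n : ℝ) ^ (m + 5)) := by
  have hn1 := h.n_real
  have hn : (0 : ℝ) < n := by linarith
  have hl := h.log_nonneg
  set p := momentSize m n with hp
  set N : ℝ := (#(adjFinset din dout) : ℝ) with hN
  have hN0 : 0 ≤ N := Nat.cast_nonneg _
  have hpn : p * √(n : ℝ) ≤ 1 / 20 * n := by
    have h1 := h.momentSize_le
    rw [← hp] at h1
    have h2 := h.sqrt_ge
    have h3 : √(d : ℝ) ≤ √(n : ℝ) := Real.sqrt_le_sqrt (by linarith [h.d_le])
    have h4 : (p : ℝ) ≤ 1 / 20 * √(n : ℝ) := by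
      have h5 : (0 : ℝ) ≤ m * (1 + Real.log n) := by positivity
      unfold growthConst at h2
      nlinarith
    calc p * √(n : ℝ) ≤ 1 / 20 * √(n : ℝ) * √(n : ℝ) := by gcongr
      _ = 1 / 20 * n := by rw [mul_assoc, Real.mul_self_sqrt hn.le]
  have main := card_large_sum_le (adjFinset din dout)
    (fun M j => lam / √(d : ℝ) * (σ * colDev din I M j)) (b := √(n : ℝ)) (c := 13 / 10 * n)
    (B := N * (Real.exp (p / 10) + 1)) p (Real.sqrt_nonneg _) (by positivity) (by
      intro J hJ
      have := h.sum_exp_colDev_le hlam hlamL hσ I J (by rw [hJ]; exact h.momentSize_le)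
      rw [hJ] at this
      simpa only [← mul_sum] using this) (by positivity)
  refine le_trans ?_ (main.trans ?_)
  · refine Nat.cast_le.2 (card_le_card fun M hM => ?_)
    obtain ⟨hM, hM1, hM2⟩ := mem_filter.1 hM
    exact mem_filter.2 ⟨hM, hM1, by linarith⟩
  · rw [Fintype.card_fin]
    have e1 : (n : ℝ) / (13 / 10 * n) = (13 / 10)⁻¹ := by field_simp
    have e2 : Real.exp (p / 4) ≤ (13 / 10) ^ p := by
      have : Real.exp (p / 4) = Real.exp (1 / 4) ^ p := by
        rw [← Real.exp_nat_mul]; ring_nf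
      rw [this]
      exact pow_le_pow_left₀ (Real.exp_pos _).le exp_one_div_four_le p
    have e3 : Real.exp (p / 10) + 1 ≤ 2 * Real.exp (p / 10) := by
      have : 1 ≤ Real.exp ((p : ℝ) / 10) := Real.one_le_exp (by positivity)
      linarith
    have e4 : (n : ℝ) ^ (m + 5) = Real.exp (((m + 5 : ℕ) : ℝ) * Real.log n) := by
      rw [Real.exp_nat_mul, Real.exp_log hn]
    have e5 : ((m + 5 : ℕ) : ℝ) * Real.log n ≤ 3 / 20 * p := by
      have : 7 * ((m : ℝ) + 5) * (1 + Real.log n) ≤ p := Nat.le_ceil _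
      have h5 : (0 : ℝ) ≤ m * Real.log n := by positivity
      push_cast
      nlinarith [(Nat.cast_nonneg m : (0 : ℝ) ≤ m)]
    rw [e1, inv_pow]
    calc ((13 / 10 : ℝ) ^ p)⁻¹ * (N * (Real.exp (p / 10) + 1))
        ≤ (Real.exp (p / 4))⁻¹ * (N * (2 * Real.exp (p / 10))) := by gcongr
      _ = N * (2 * Real.exp (-(3 / 20 * p))) := by
          have : Real.exp (-(3 / 20 * (p : ℝ))) = (Real.exp (p / 4))⁻¹ * Real.exp (p / 10) := by
            rw [← Real.exp_neg, ← Real.exp_add]; ring_nf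
          rw [this]; ring
      _ ≤ N * (2 * Real.exp (-(((m + 5 : ℕ) : ℝ) * Real.log n))) := by gcongr
      _ = N * (2 / (n : ℝ) ^ (m + 5)) := by rw [e4, Real.exp_neg, div_eq_mul_inv]

/-- The scale, in units of `√d`, at which the column deviations are controlled. -/
def devScale (L : ℝ) (m : ℕ) : ℝ := 2400 * L * (m + 6)

open scoped Classical in
/-- For a given set of rows, the vector of column deviations has Orlicz norm of order `√d` with
polynomially high probability. -/
theorem card_colDev_large_le (h : DenseRegime L m n d din dout) (I : Finset (Fin n)) :
    (#{M ∈ adjFinset din dout | Real.exp 1 * n <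
        ∑ j, Real.exp (|colDev din I M j| / (devScale L m * √(d : ℝ)))} : ℝ) ≤
      #(adjFinset din dout) * (10 / (n : ℝ) ^ (m + 5)) := by
  have hn1 := h.n_real
  have hn : (0 : ℝ) < n := by linarith
  have hL := h.one_le
  have hs := h.sqrt_pos
  have hm : (0 : ℝ) ≤ m := Nat.cast_nonneg m
  set N : ℝ := (#(adjFinset din dout) : ℝ) with hN
  have hN0 : 0 ≤ N := Nat.cast_nonneg _
  set lam : ℝ := 1 / devScale L m with hlam
  have hsc : 0 < devScale L m := by unfold devScale; positivity
  have hlam0 : 0 ≤ lam := by positivity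
  have hlamL : lam * (1200 * L) ≤ 1 := by
    rw [hlam, one_div_mul_eq_div, div_le_one hsc]
    unfold devScale
    nlinarith
  set P : ℝ → Fin n → Finset (Matrix (Fin n) (Fin n) ℕ) := fun σ j =>
    {M ∈ adjFinset din dout |
        (m + 6) * Real.log n ≤ 1 / (1200 * L) / √(d : ℝ) * (σ * colDev din I M j)} with hP
  set Q : ℝ → Finset (Matrix (Fin n) (Fin n) ℕ) := fun σ =>
    {M ∈ adjFinset din dout |
        (∀ j, Real.exp (lam / √(d : ℝ) * (σ * colDev din I M j)) ≤ √(n : ℝ)) ∧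
        27 / 20 * n ≤ ∑ j, Real.exp (lam / √(d : ℝ) * (σ * colDev din I M j))} with hQ
  have hcover : ({M ∈ adjFinset din dout | Real.exp 1 * n <
        ∑ j, Real.exp (|colDev din I M j| / (devScale L m * √(d : ℝ)))}) ⊆
      ((univ.biUnion (P 1) ∪ univ.biUnion (P (-1))) ∪ (Q 1 ∪ Q (-1))) := by
    intro M hM
    obtain ⟨hM, hlarge⟩ := mem_filter.1 hM
    by_contra hcon
    simp only [mem_union, mem_biUnion, mem_univ, true_and, not_or, not_exists, hP, hQ,
      mem_filter, hM, not_and, not_le] at hcon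
    obtain ⟨⟨h1, h2⟩, h3, h4⟩ := hcon
    -- the scale is `2 (m + 6)` times coarser than the one of the tail bound
    have hb : ∀ t : ℝ, 1 / (1200 * L) / √(d : ℝ) * t < (m + 6) * Real.log n →
        Real.exp (lam / √(d : ℝ) * t) ≤ √(n : ℝ) := by
      intro t ht
      have e1 : lam / √(d : ℝ) * t = 1 / (1200 * L) / √(d : ℝ) * t / (2 * (m + 6)) := by
        rw [hlam]; unfold devScale; field_simp; ring
      have e2 : √(n : ℝ) = Real.exp (Real.log n / 2) := by
        rw [← Real.log_sqrt hn.le, Real.exp_log (Real.sqrt_pos.2 hn)]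
      rw [e1, e2]
      refine Real.exp_le_exp.2 ?_
      rw [div_le_div_iff₀ (by positivity) (by norm_num)]
      linarith
    have h5 := h3 fun j => hb _ (h1 j)
    have h6 := h4 fun j => hb _ (h2 j)
    have h7 : ∀ j, Real.exp (|colDev din I M j| / (devScale L m * √(d : ℝ))) ≤
        Real.exp (lam / √(d : ℝ) * (1 * colDev din I M j)) +
          Real.exp (lam / √(d : ℝ) * (-1 * colDev din I M j)) := by
      intro j
      have e : |colDev din I M j| / (devScale L m * √(d : ℝ)) =
          lam / √(d : ℝ) * |colDev din I M j| := by
        rw [hlam]; field_simp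
      rw [e]
      rcases abs_choice (colDev din I M j) with hc | hc <;> rw [hc]
      · rw [one_mul]; linarith [Real.exp_pos (lam / √(d : ℝ) * (-1 * colDev din I M j))]
      · rw [neg_one_mul]; linarith [Real.exp_pos (lam / √(d : ℝ) * (1 * colDev din I M j))]
    have h8 := sum_le_sum fun j (_ : j ∈ (univ : Finset (Fin n))) => h7 j
    rw [sum_add_distrib] at h8
    nlinarith [Real.exp_one_gt_d9]
  have hPle : ∀ σ : ℝ, σ = 1 ∨ σ = -1 →
      ((#(univ.biUnion (P σ)) : ℕ) : ℝ) ≤ N * (3 / (n : ℝ) ^ (m + 5)) := by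
    intro σ hσ
    refine (Nat.cast_le.2 card_biUnion_le).trans ?_
    push_cast
    refine (sum_le_card_nsmul _ _ _ fun j _ => h.card_colDev_le hσ I j).trans (le_of_eq ?_)
    rw [nsmul_eq_mul, card_univ, Fintype.card_fin, ← hN, pow_succ (n : ℝ) (m + 5)]
    field_simp
  have hQle : ∀ σ : ℝ, σ = 1 ∨ σ = -1 → (#(Q σ) : ℝ) ≤ N * (2 / (n : ℝ) ^ (m + 5)) :=
    fun σ hσ => h.card_sum_exp_le hσ hlam0 hlamL I
  have hc : (#({M ∈ adjFinset din dout | Real.exp 1 * n <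
        ∑ j, Real.exp (|colDev din I M j| / (devScale L m * √(d : ℝ)))}) : ℝ) ≤
      ((#(univ.biUnion (P 1)) : ℕ) + (#(univ.biUnion (P (-1))) : ℕ)) +
        ((#(Q 1) : ℕ) + (#(Q (-1)) : ℕ)) := by
    exact_mod_cast (card_le_card hcover).trans ((card_union_le _ _).trans
      (add_le_add (card_union_le _ _) (card_union_le _ _)))
  refine hc.trans ?_
  have h1 := hPle 1 (Or.inl rfl)
  have h2 := hPle (-1) (Or.inr rfl)
  have h3 := hQle 1 (Or.inl rfl)
  have h4 := hQle (-1) (Or.inr rfl)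
  have e : N * (10 / (n : ℝ) ^ (m + 5)) = N * (3 / (n : ℝ) ^ (m + 5)) + N * (3 / (n : ℝ) ^ (m + 5))
      + (N * (2 / (n : ℝ) ^ (m + 5)) + N * (2 / (n : ℝ) ^ (m + 5))) := by ring
  rw [e]
  exact add_le_add (add_le_add h1 h2) (add_le_add h3 h4)

/-- Control of the column deviations implies control of the vector `P^col`. -/
theorem psiNorm_vecPCol_le (h : DenseRegime L m n d din dout) (I : Finset (Fin n))
    {M : Matrix (Fin n) (Fin n) ℕ} (hM : M ∈ adjFinset din dout)
    (hdev : ∑ j, Real.exp (|colDev din I M j| / (devScale L m * √(d : ℝ))) ≤ Real.exp 1 * n) :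
    psiNorm (vecPCol I M) ≤ 8 * devScale L m * n * √(d : ℝ) := by
  have hn : 0 < n := by linarith [h.le_n]
  have hL := h.one_le
  have hs := h.sqrt_pos
  have hm : (0 : ℝ) ≤ m := Nat.cast_nonneg m
  have hsc : 2 * L ≤ devScale L m := by unfold devScale; nlinarith
  have hA : 0 < devScale L m * √(d : ℝ) := mul_pos (by linarith) hs
  have hu : ∑ j, Real.exp (((d : ℝ) - din j) / (devScale L m * √(d : ℝ))) ≤ Real.exp 1 * n := by
    refine (sum_le_sum fun j _ => ?_).trans h.exp_din
    refine Real.exp_le_exp.2 (div_le_div_of_nonneg_left (sub_nonneg.2 (h.din_le j)) h.scale_pos ?_)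
    gcongr
  have hp : ∀ j, (pCol I M j : ℝ) = (1 - (#I : ℝ) / n) * din j - colDev din I M j := by
    intro j
    have h01 := fun i => (mem_adjFinset.1 hM).1 i j
    have h1 : pCol I M j = #{q ∈ Iᶜ | M q j = 1} := by
      rw [pCol]
      congr 1
      ext q
      simp
    have h2 := sum_add_sum_compl I (fun i => (M i j : ℝ))
    rw [sum_col hM j] at h2
    rw [h1, card_ones_eq_sum _ h01, colDev]
    linarith
  have hI : (#I : ℝ) / n ≤ 1 :=
    div_le_one_of_le₀ (by exact_mod_cast (card_le_univ I).trans (by simp)) (Nat.cast_nonneg _)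
  have hI0 : 0 ≤ (#I : ℝ) / n := by positivity
  refine (psiNorm_le_of_sum_exp hA hn hu hdev fun j => ?_).trans (le_of_eq (by ring))
  rw [vecPCol, abs_of_nonneg (sum_nonneg fun l _ => abs_nonneg _)]
  refine sum_le_sum fun l _ => ?_
  rw [hp, hp]
  have hj := h.din_le j
  have hl := h.din_le l
  have h1 : |(1 - (#I : ℝ) / n) * ((din j : ℝ) - din l)| ≤ ((d : ℝ) - din j) + (d - din l) := by
    rw [abs_mul, abs_of_nonneg (sub_nonneg.2 hI)]
    refine (mul_le_of_le_one_left (abs_nonneg _) (by linarith)).trans ?_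
    rw [abs_le]; constructor <;> linarith
  have h2 : (1 - (#I : ℝ) / n) * din j - colDev din I M j -
      ((1 - (#I : ℝ) / n) * din l - colDev din I M l) =
      (1 - (#I : ℝ) / n) * ((din j : ℝ) - din l) + (colDev din I M l - colDev din I M j) := by ring
  rw [h2]
  have h3 := abs_add_le ((1 - (#I : ℝ) / n) * ((din j : ℝ) - din l))
    (colDev din I M l - colDev din I M j)
  have h4 := abs_sub (colDev din I M l) (colDev din I M j)
  linarith

end DenseRegime

theorem transpose_mem_adjFinset {n : ℕ} {din dout : Fin n → ℕ} {M : Matrix (Fin n) (Fin n) ℕ}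
    (hM : M ∈ adjFinset din dout) : M.transpose ∈ adjFinset dout din := by
  have h := mem_adjFinset.1 hM
  exact mem_adjFinset.2 ⟨fun i j => h.1 j i, h.2.2, h.2.1⟩

/-- The sets of consecutive indices. -/
def intervals (n : ℕ) : Finset (Finset (Fin n)) :=
  insert ∅ ((univ : Finset (Fin n × Fin n)).image fun q => Icc q.1 q.2)

theorem mem_intervals {n : ℕ} {I : Finset (Fin n)} (hI : (I : Set (Fin n)).OrdConnected) :
    I ∈ intervals n := by
  rw [intervals, mem_insert, mem_image]
  rcases I.eq_empty_or_nonempty with h | h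
  · exact Or.inl h
  · refine Or.inr ⟨(I.min' h, I.max' h), mem_univ _, ?_⟩
    ext x
    rw [mem_Icc]
    constructor
    · rintro ⟨h1, h2⟩
      exact mem_coe.1 (hI.out (mem_coe.2 (I.min'_mem h)) (mem_coe.2 (I.max'_mem h)) ⟨h1, h2⟩)
    · intro hx
      exact ⟨I.min'_le x hx, I.le_max' x hx⟩

theorem card_intervals_le (n : ℕ) : #(intervals n) ≤ n * n + 1 := by
  refine (card_insert_le _ _).trans (Nat.add_le_add_right ?_ 1)
  refine card_image_le.trans ?_
  simp

namespace DenseRegime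

variable {L : ℝ} {m n d : ℕ} {din dout : Fin n → ℕ}

open scoped Classical in
/-- The union bound over all intervals, for columns and, through transposition, for rows. -/
theorem card_not_mem_eventP_le (h : DenseRegime L m n d din dout) :
    (#{M ∈ adjFinset din dout | M ∉ eventP d din dout (8 * devScale L m)} : ℝ) ≤
      #(adjFinset din dout) * (1 / (n : ℝ) ^ m) := by
  have hn1 := h.n_real
  have hn : (0 : ℝ) < n := by linarith
  set N : ℝ := (#(adjFinset din dout) : ℝ) with hN
  have hN0 : 0 ≤ N := Nat.cast_nonneg _
  set bad : (Fin n → ℕ) → Finset (Fin n) → Matrix (Fin n) (Fin n) ℕ → Prop := fun e I M =>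
    Real.exp 1 * n < ∑ j, Real.exp (|colDev e I M j| / (devScale L m * √(d : ℝ))) with hbad
  have hcover : ({M ∈ adjFinset din dout | M ∉ eventP d din dout (8 * devScale L m)}) ⊆
      ((intervals n).biUnion fun I => ({M ∈ adjFinset din dout | bad din I M} ∪
        {M ∈ adjFinset din dout | bad dout I M.transpose})) := by
    intro M hM
    obtain ⟨hM, hE⟩ := mem_filter.1 hM
    by_contra hcon
    simp only [mem_biUnion, mem_union, mem_filter, hM, true_and, not_exists, not_and, not_or,
      hbad, not_lt] at hcon
    refine hE ⟨mem_adjFinset.1 hM, fun I hI _ => ?_⟩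
    obtain ⟨h1, h2⟩ := hcon I (mem_intervals hI)
    exact ⟨h.swap.psiNorm_vecPCol_le I (transpose_mem_adjFinset hM) h2,
      h.psiNorm_vecPCol_le I hM h1⟩
  have hcol : ∀ I, (#{M ∈ adjFinset din dout | bad din I M} : ℝ) ≤
      N * (10 / (n : ℝ) ^ (m + 5)) := h.card_colDev_large_le
  have htr : ∀ e e' : Fin n → ℕ, ∀ I, #{M ∈ adjFinset e e' | bad e' I M.transpose} ≤
      #{M ∈ adjFinset e' e | bad e' I M} := by
    intro e e' I
    refine card_le_card_of_injOn Matrix.transpose (fun M hM => ?_)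
      (Matrix.transpose_injective.injOn)
    obtain ⟨h1, h2⟩ := mem_filter.1 (mem_coe.1 hM)
    exact mem_coe.2 (mem_filter.2 ⟨transpose_mem_adjFinset h1, h2⟩)
  have hcard : #(adjFinset dout din) ≤ #(adjFinset din dout) :=
    card_le_card_of_injOn Matrix.transpose (fun M hM => mem_coe.2 (transpose_mem_adjFinset hM))
      (Matrix.transpose_injective.injOn)
  have hrow : ∀ I, (#{M ∈ adjFinset din dout | bad dout I M.transpose} : ℝ) ≤
      N * (10 / (n : ℝ) ^ (m + 5)) := by
    intro I
    refine (Nat.cast_le.2 (htr din dout I)).trans ((h.swap.card_colDev_large_le I).trans ?_)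
    exact mul_le_mul_of_nonneg_right (Nat.cast_le.2 hcard) (by positivity)
  calc _ ≤ ∑ _I ∈ intervals n, (N * (10 / (n : ℝ) ^ (m + 5)) + N * (10 / (n : ℝ) ^ (m + 5))) := by
        refine (Nat.cast_le.2 ((card_le_card hcover).trans card_biUnion_le)).trans ?_
        push_cast
        refine sum_le_sum fun I _ => ?_
        refine le_trans ?_ (add_le_add (hcol I) (hrow I))
        exact_mod_cast card_union_le _ _
    _ = #(intervals n) * (20 * (N / (n : ℝ) ^ (m + 5))) := by
        rw [sum_const, nsmul_eq_mul]; ring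
    _ ≤ (n * n + 1) * (20 * (N / (n : ℝ) ^ (m + 5))) := by
        gcongr
        exact_mod_cast card_intervals_le n
    _ ≤ (n : ℝ) ^ 5 * (N / (n : ℝ) ^ (m + 5)) := by
        rw [← mul_assoc]
        refine mul_le_mul_of_nonneg_right ?_ (by positivity)
        have h2 : (1000 : ℝ) ≤ n ^ 3 := by
          nlinarith [pow_le_pow_left₀ (by norm_num : (0 : ℝ) ≤ 1000) hn1 3]
        have h3 : (1 : ℝ) ≤ n ^ 2 := one_le_pow₀ (by linarith)
        have h4 : (n : ℝ) ^ 5 = n ^ 2 * n ^ 3 := by ring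
        rw [h4]
        nlinarith
    _ = N * (1 / (n : ℝ) ^ m) := by
        rw [pow_add]
        field_simp

theorem le_uniformProb (h : DenseRegime L m n d din dout) (hne : (adjMatrices din dout).Nonempty) :
    1 - 1 / (n : ℝ) ^ m ≤
      uniformProb (adjMatrices din dout) (eventP d din dout (8 * devScale L m)) := by
  classical
  have h1 := h.card_not_mem_eventP_le
  have hS : (adjMatrices din dout).ncard = #(adjFinset din dout) := by
    rw [← Set.ncard_coe_finset]
    congr 1
    ext M
    exact (mem_adjFinset (M := M)).symm
  have hSE : (adjMatrices din dout ∩ eventP d din dout (8 * devScale L m)).ncard =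
      #{M ∈ adjFinset din dout | M ∈ eventP d din dout (8 * devScale L m)} := by
    rw [← Set.ncard_coe_finset]
    congr 1
    ext M
    simp [mem_adjFinset]
  have hN : (0 : ℝ) < #(adjFinset din dout) := by
    obtain ⟨M, hM⟩ := hne
    exact_mod_cast card_pos.2 ⟨M, mem_adjFinset.2 hM⟩
  rw [uniformProb, hS, hSE, le_div_iff₀ hN]
  have h2 : (#{M ∈ adjFinset din dout | M ∈ eventP d din dout (8 * devScale L m)} : ℝ) +
      #{M ∈ adjFinset din dout | M ∉ eventP d din dout (8 * devScale L m)} =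
      #(adjFinset din dout) := by
    exact_mod_cast card_filter_add_card_filter_not _
  linarith

end DenseRegime

theorem eventP_mono {n d : ℕ} {din dout : Fin n → ℕ} {R R' : ℝ} (hR : R ≤ R') :
    eventP d din dout R ⊆ eventP d din dout R' := by
  rintro M ⟨hM, h⟩
  have hle : R * n * √(d : ℝ) ≤ R' * n * √(d : ℝ) := by gcongr
  exact ⟨hM, fun I hI hc => ⟨(h I hI hc).1.trans hle, (h I hI hc).2.trans hle⟩⟩

theorem uniformProb_mono {Ω : Type*} {S E E' : Set Ω} (hS : S.Finite) (hE : E ⊆ E') :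
    uniformProb S E ≤ uniformProb S E' := by
  unfold uniformProb
  gcongr
  exact hS.subset Set.inter_subset_left

/-- Squared logarithms are eventually dominated by `√(n ^ a)`. -/
theorem exists_growth {a C : ℝ} (ha : 0 < a) (hC : 1 ≤ C) :
    ∃ n₀ : ℕ, ∀ n : ℕ, n₀ ≤ n → C * (1 + Real.log n) ^ 2 ≤ √((n : ℝ) ^ a) := by
  have h1 := (isLittleO_log_rpow_atTop (by positivity : 0 < a / 4)).bound
    (by positivity : 0 < 1 / (2 * C))
  have h2 := (tendsto_natCast_atTop_atTop (R := ℝ)).eventually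
    (h1.and (Filter.eventually_ge_atTop (Real.exp 1)))
  obtain ⟨n₀, hn₀⟩ := Filter.eventually_atTop.1 h2
  refine ⟨n₀, fun n hn => ?_⟩
  obtain ⟨h3, h4⟩ := hn₀ n hn
  have hnpos : (0 : ℝ) < n := (Real.exp_pos 1).trans_le h4
  have hlog : 1 ≤ Real.log n := by rwa [Real.le_log_iff_exp_le hnpos]
  set y := (n : ℝ) ^ (a / 4) with hy
  have hy0 : 0 < y := Real.rpow_pos_of_pos hnpos _
  rw [Real.norm_of_nonneg (by linarith), Real.norm_of_nonneg hy0.le] at h3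
  have h5 : (n : ℝ) ^ a = (y ^ 2) ^ 2 := by
    rw [hy, ← pow_mul, ← Real.rpow_mul_natCast hnpos.le]
    congr 1
    push_cast; ring
  rw [h5, Real.sqrt_sq (by positivity)]
  have h6 : 1 + Real.log n ≤ y / C := by
    have : 1 / (2 * C) * y = y / C / 2 := by field_simp
    linarith
  calc C * (1 + Real.log n) ^ 2 ≤ C * (y / C) ^ 2 := by gcongr
    _ = y ^ 2 / C := by field_simp
    _ ≤ y ^ 2 := div_le_self (by positivity) hC

/-- The degree condition, the growth of `d` and the bounds on the Orlicz norms put the degree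
sequences into the dense regime. -/
theorem DenseRegime.of_degreeCondition {L : ℝ} {m n d : ℕ} {din dout : Fin n → ℕ} (hL : 1 ≤ L)
    (hn : 1000 ≤ n) (hdeg : DegreeCondition d din dout)
    (hgrowth : growthConst m * (1 + Real.log n) ^ 2 ≤ √(d : ℝ))
    (hin : psiNorm (fun i => (din i : ℝ) - (d : ℝ)) ≤ L * √(d : ℝ))
    (hout : psiNorm (fun i => (dout i : ℝ) - (d : ℝ)) ≤ L * √(d : ℝ)) :
    DenseRegime L m n d din dout := by
  obtain ⟨h1, h2, h3⟩ := hdeg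
  have hc : (1 : ℝ) - cZero = 999 / 1000 := by norm_num [cZero]
  have hn' : (1000 : ℝ) ≤ n := by exact_mod_cast hn
  have hs : 0 < √(d : ℝ) := by
    refine lt_of_lt_of_le ?_ hgrowth
    have : (406000 : ℝ) ≤ growthConst m := DenseRegime.growthConst_le
    have := Real.log_nonneg (by linarith : (1 : ℝ) ≤ n)
    positivity
  have hlt : L * √(d : ℝ) < 2 * L * √(d : ℝ) := by nlinarith
  have hpsi : ∀ e : Fin n → ℕ, (∀ i, (e i : ℝ) ≤ d) →
      psiNorm (fun i => (e i : ℝ) - (d : ℝ)) ≤ L * √(d : ℝ) →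
      ∑ i, Real.exp (((d : ℝ) - e i) / (2 * L * √(d : ℝ))) ≤ Real.exp 1 * n := by
    intro e he hpe
    refine le_trans (le_of_eq (sum_congr rfl fun i _ => ?_))
      (sum_exp_le_of_psiNorm_lt (by linarith) (hpe.trans_lt hlt))
    rw [abs_sub_comm, abs_of_nonneg (sub_nonneg.2 (he i))]
  have hdin : ∀ i, (din i : ℝ) ≤ d := fun i => by exact_mod_cast (h1 i).2
  have hdout : ∀ i, (dout i : ℝ) ≤ d := fun i => by exact_mod_cast (h2 i).2
  exact ⟨hL, hn, h3.trans_eq (by norm_num [cZero]), hgrowth, fun i => hc ▸ (h1 i).1, hdin,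
    fun i => hc ▸ (h2 i).1, hdout, hpsi din hdin hin, hpsi dout hdout hout⟩

theorem propositionp (L : ℝ) (hL : 1 ≤ L) (m : ℕ) :
    ∃ Lt : ℝ, 0 < Lt ∧
      ∀ a : ℝ, 0 < a → a < 1 →
        ∃ n₀ : ℕ, ∀ n : ℕ, n₀ ≤ n →
          ∀ (d : ℕ) (din dout : Fin n → ℕ),
            DegreeCondition d din dout →
            (adjMatrices din dout).Nonempty →
            (n : ℝ) ^ a ≤ (d : ℝ) →
            psiNorm (fun i => (din i : ℝ) - (d : ℝ)) ≤ L * √(d : ℝ) →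
            psiNorm (fun i => (dout i : ℝ) - (d : ℝ)) ≤ L * √(d : ℝ) →
            1 - 1 / (n : ℝ) ^ m ≤
              uniformProb (adjMatrices din dout) (eventP d din dout (a⁻¹ * Lt)) := by
  have hpos : 0 < 8 * DenseRegime.devScale L m := by
    unfold DenseRegime.devScale
    positivity
  -- since `a⁻¹ ≥ 1`, it suffices to treat `eventP` with the radius `8 * devScale L m` itself
  refine ⟨8 * DenseRegime.devScale L m, hpos, fun a ha ha1 => ?_⟩
  obtain ⟨n₀, hn₀⟩ := exists_growth (a := a) (C := growthConst m) ha
    (by linarith [DenseRegime.growthConst_le (m := m)])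
  refine ⟨max n₀ 1000, fun n hn d din dout hdeg hne hd hin hout => ?_⟩
  have hreg : DenseRegime L m n d din dout :=
    .of_degreeCondition hL ((le_max_right _ _).trans hn) hdeg
      ((hn₀ n ((le_max_left _ _).trans hn)).trans (Real.sqrt_le_sqrt hd)) hin hout
  refine (hreg.le_uniformProb hne).trans (uniformProb_mono (adjMatrices_finite din dout) ?_)
  exact eventP_mono (le_mul_of_one_le_left hpos.le (one_le_inv_iff₀.2 ⟨ha, ha1.le⟩))
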